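/- Identify $S^3$ with $SU(2)$ by $p=\begin{pmatrix}s&-\bar t\\ t&\bar s\end{pmatrix}$, $s\bar s+t\bar t=1$, and let $\Gamma\subset SU(2)$ be the binary tetrahedral group (of order 24) generated by $\begin{pmatrix}i&0\\0&-i\end{pmatrix}$ and $\frac12\begin{pmatrix}1+i&-1+i\\1+i&1-i\end{pmatrix}$, acting on $S^3$ by left multiplication. Let $J_z^R=\frac12(s\partial_s-\bar t\partial_{\bar t}+t\partial_t-\bar s\partial_{\bar s})$, $J_+^R=-s\partial_{\bar t}+t\partial_{\bar s}$, $J_-^R=-\bar t\partial_s+\bar s\partial_t$, let $$V=s^4+t^4+2i\sqrt3\,s^2t^2,\qquad v_l=\tfrac{(4-l)!}{4!}(J_-^R)^lV\quad(l=0,\dots,4),$$ and let $v=(v_0,\dots,v_4):S^3\to\mathbb C^5$. On $\mathbb C[X_0,\dots,X_4]$ let $L_z,L_+,L_-$ be the derivations $L_zX_l=(2-l)X_l$, $L_+X_l=l\,X_{l-1}$, $L_-X_l=(4-l)X_{l+1}$. A highest weight vector of spin $j$ and degree $d$ is a homogeneous $F$ of degree $d$ with $L_+F=0$, $L_zF=jF$;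 the multiplicity of spin $j$ in degree $d$ is the dimension of the space of these. A function on $S^3/\Gamma$ means one whose pull-back to $S^3$ is a polynomial in $s,t,\bar s,\bar t$ (equivalently, a finite sum of eigenfunctions of the Laplacian). Then: 1. There is a non-trivial character $\chi:\Gamma\to\mathbb C^\times$ with $\chi^3=1$ such that $V(\gamma\cdot(s,t))=\chi(\gamma)V(s,t)$ for all $(s,t)\in\mathbb C^2$ and $v(\gamma p)=\chi(\gamma)v(p)$ for all $\gamma\in\Gamma$, $p\in S^3$. 2. $v_0,\dots,v_4$ form a spin-2 multiplet of $SU(2)^R$: $J_z^Rv_l=(2-l)v_l$, $J_+^Rv_l=l\,v_{l-1}$, $J_-^Rv_l=(4-l)v_{l+1}$; they are linearly independent functions on $S^3$, and for each $g\in SU(2)$ there is a matrix $A$ with $v(pg)=A\,v(p)$ for all $p$. 3. $v$ has no zero on $S^3$, and $p\mapsto[v_0(p):\dots:v_4(p)]$ induces an embedding $S^3/\Gamma\to\mathbb P^4(\mathbb C)$ (a topological embedding, and an immersion). 4. In degree 2 the spins $0,2,4$ occur, each with multiplicity one, and no others. A quadratic form in five variables vanishes on $v(S^3)$ if and only if it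 is a spin-0 one; thus there is, up to scalars, a single quadratic relation between the $v_l$. If $F\neq0$ is a highest weight vector of degree 2 and spin 2, then $F(v)$ is a non-zero multiple of $s^4+t^4-2i\sqrt3\,s^2t^2$, and there is $c\ne0$ with $\overline{v_l}=c\,(-1)^l F_{4-l}(v)$ on $S^3$ for all $l$, where $F_k=\frac{(4-k)!}{4!}L_-^kF$. 5. In degree 3 the spins $0,2,3,4,6$ occur, each with multiplicity one, and no others. If $K\ne0$ is a spin-0 cubic, then $K(v)$ is a non-zero constant $c$ on $S^3$, and a vector $z=\lambda v(p)$, $\lambda\in\mathbb C^\times$, satisfies $K(z)=c$ if and only if $z=\zeta v(p)$ with $\zeta^3=1$. The highest weight vectors of spin 2 are the products of $X_0$ with the spin-0 quadratic forms. Non-zero highest weight vectors of spin 3, 4, 6 take on $v$ the values of non-zero multiples of $P=st(s^4-t^4)$, $W=s^8+14s^4t^4+t^8$ and $V^3$ respectively, and $P,W,V^3$ generate the algebra $\mathbb C[s,t]^\Gamma$. 6. If $F\in\mathbb C[X_0,\dots,X_4]$ is homogeneous of degree $3n$, then $F(v)$ is $\Gamma$-invariant. A function $f:S^3/\Gamma\to\mathbb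 C$ is a function on the quotient in the above sense if and only if, for some $n\geq0$, there is $F$ homogeneous of degree $3n$ such that $f$ pulls back to $F(v)$ on $S^3$. -/

import Mathlib

noncomputable section

namespace TetrahedralQuotient

open MvPolynomial
open scoped ComplexConjugate

/-- The three-sphere, identified with the group `SU(2)`: a point is a matrix
`p = !![s, -conj t; t, conj s]` with `s * conj s + t * conj t = 1`. -/
abbrev SU2 : Type := Matrix.specialUnitaryGroup (Fin 2) ℂ

/-- The element `i` of the binary tetrahedral group. -/
def genI : SU2 :=
  ⟨!![Complex.I, 0; 0, -Complex.I], by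
    rw [Matrix.mem_specialUnitaryGroup_iff, Matrix.mem_unitaryGroup_iff]
    constructor
    · ext a b
      fin_cases a <;> fin_cases b <;> simp [Matrix.mul_apply, Fin.sum_univ_two]
    · simp [Matrix.det_fin_two]⟩

/-- An element of order six of the binary tetrahedral group, of the form
`(1 ± i ± j ± k) / 2`. -/
def genOmega : SU2 :=
  ⟨!![(1 + Complex.I) / 2, (-1 + Complex.I) / 2; (1 + Complex.I) / 2, (1 - Complex.I) / 2], by
    rw [Matrix.mem_specialUnitaryGroup_iff, Matrix.mem_unitaryGroup_iff]
    constructor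
    · ext a b
      have h2 : (starRingEnd ℂ) 2 = 2 := Complex.conj_ofNat 2
      fin_cases a <;> fin_cases b <;>
        simp [Matrix.mul_apply, Fin.sum_univ_two, h2, Complex.ext_iff] <;> norm_num
    · simp [Matrix.det_fin_two, Complex.ext_iff]
      norm_num⟩

/-- The (binary) tetrahedral group, of order 24, in the position for which the zeros of the
form `formV` are the vertices of the tetrahedron. -/
def tetra : Subgroup SU2 := Subgroup.closure {genI, genOmega}

/-- The quotient of the three-sphere by the tetrahedral group acting by left translations. -/
abbrev Quot3 : Type := MulAction.orbitRel.Quotient tetra SU2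

/-- The projection of the sphere to the quotient. -/
def proj (p : SU2) : Quot3 := Quotient.mk _ p

/-- The quotient topology on the complex projective space of dimension four. -/
instance instTopologicalSpaceProj : TopologicalSpace (Projectivization ℂ (Fin 5 → ℂ)) :=
  TopologicalSpace.coinduced
    (fun x : {x : Fin 5 → ℂ // x ≠ 0} => Projectivization.mk ℂ x.1 x.2) inferInstance

/-! ### Binary forms in `s = X 0`, `t = X 1` -/

/-- `V = s⁴ + t⁴ + 2 i √3 s² t²`. -/
def formV : MvPolynomial (Fin 2) ℂ :=
  X 0 ^ 4 + X 1 ^ 4 + C (2 * Complex.I * (Real.sqrt 3 : ℂ)) * X 0 ^ 2 * X 1 ^ 2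

/-- `V` with `i` replaced by `-i`. -/
def formVbar : MvPolynomial (Fin 2) ℂ :=
  X 0 ^ 4 + X 1 ^ 4 - C (2 * Complex.I * (Real.sqrt 3 : ℂ)) * X 0 ^ 2 * X 1 ^ 2

/-- `P = s t (s⁴ - t⁴)`. -/
def formP : MvPolynomial (Fin 2) ℂ := X 0 * X 1 * (X 0 ^ 4 - X 1 ^ 4)

/-- The form of degree eight `s⁸ + 14 s⁴ t⁴ + t⁸`. -/
def formW : MvPolynomial (Fin 2) ℂ := X 0 ^ 8 + 14 * X 0 ^ 4 * X 1 ^ 4 + X 1 ^ 8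

/-- The values `(s, t)` at a point of the sphere. -/
def st (p : SU2) : Fin 2 → ℂ := ![p.1 0 0, p.1 1 0]

/-! ### Polynomials in `s = X 0`, `t = X 1`, `conj s = X 2`, `conj t = X 3` -/

/-- `J_z^R = (s ∂_s - t̄ ∂_t̄ + t ∂_t - s̄ ∂_s̄) / 2`. -/
def JZ : Derivation ℂ (MvPolynomial (Fin 4) ℂ) (MvPolynomial (Fin 4) ℂ) :=
  mkDerivation ℂ ![C (1 / 2) * X 0, C (1 / 2) * X 1, -(C (1 / 2) * X 2), -(C (1 / 2) * X 3)]

/-- `J_+^R = -s ∂_t̄ + t ∂_s̄`. -/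
def JPlus : Derivation ℂ (MvPolynomial (Fin 4) ℂ) (MvPolynomial (Fin 4) ℂ) :=
  mkDerivation ℂ ![0, 0, X 1, -X 0]

/-- `J_-^R = -t̄ ∂_s + s̄ ∂_t`. -/
def JMinus : Derivation ℂ (MvPolynomial (Fin 4) ℂ) (MvPolynomial (Fin 4) ℂ) :=
  mkDerivation ℂ ![-X 3, X 2, 0, 0]

/-- The element `⟨j, j - l⟩` of the multiplet of spin `j = N / 2` with highest weight vector `f`,
for a lowering operator `D`: `(N - l)! / N! • D ^ l f`. -/
def descendant {A : Type} [CommRing A] [Algebra ℂ A] (D : Derivation ℂ A A) (N l : ℕ) (f : A) : A :=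
  (((N - l).factorial : ℂ) / (N.factorial : ℂ)) • (D^[l] f)

/-- The five elements `⟨2, 2 - l⟩`, `l = 0, …, 4`, of the spin 2 multiplet generated by `V`. -/
def multiplet (l : Fin 5) : MvPolynomial (Fin 4) ℂ :=
  descendant JMinus 4 l (rename ![0, 1] formV)

/-- The five coordinates as functions of arbitrary complex numbers `s`, `t`. -/
def coordAt (x : ℂ × ℂ) : Fin 5 → ℂ :=
  fun l => eval ![x.1, x.2, conj x.1, conj x.2] (multiplet l)

/-- The five coordinates on the three-sphere. -/
def coord (p : SU2) : Fin 5 → ℂ := coordAt (p.1 0 0, p.1 1 0)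

/-- Functions on the quotient: those whose pullback to the sphere is (the restriction of) a
polynomial in `s`, `t`, `conj s`, `conj t`, that is, a finite sum of eigenfunctions of the
Laplacian. -/
def IsPolynomialFunction (f : Quot3 → ℂ) : Prop :=
  ∃ G : MvPolynomial (Fin 4) ℂ, ∀ p : SU2,
    f (proj p) = eval ![p.1 0 0, p.1 1 0, conj (p.1 0 0), conj (p.1 1 0)] G

/-! ### Polynomials in five variables `X l = ⟨2, 2 - l⟩` carrying the spin 2 representation -/

/-- `L_z ⟨2, m⟩ = m ⟨2, m⟩`, extended as a derivation. -/
def LZ : Derivation ℂ (MvPolynomial (Fin 5) ℂ) (MvPolynomial (Fin 5) ℂ) :=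
  mkDerivation ℂ ![2 * X 0, X 1, 0, -X 3, -(2 * X 4)]

/-- `L_+ ⟨2, m⟩ = (2 - m) ⟨2, m + 1⟩`, extended as a derivation. -/
def LPlus : Derivation ℂ (MvPolynomial (Fin 5) ℂ) (MvPolynomial (Fin 5) ℂ) :=
  mkDerivation ℂ ![0, X 0, 2 * X 1, 3 * X 2, 4 * X 3]

/-- `L_- ⟨2, m⟩ = (2 + m) ⟨2, m - 1⟩`, extended as a derivation. -/
def LMinus : Derivation ℂ (MvPolynomial (Fin 5) ℂ) (MvPolynomial (Fin 5) ℂ) :=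
  mkDerivation ℂ ![4 * X 1, 3 * X 2, 2 * X 3, X 4, 0]

/-- The highest weight vectors of spin `j` among the homogeneous polynomials of degree `d` in the
five variables. Its dimension is the multiplicity of the spin `j` representation; for `j = 0` it
is the space of spin 0 combinations itself. -/
def highestWeight (d j : ℕ) : Submodule ℂ (MvPolynomial (Fin 5) ℂ) :=
  homogeneousSubmodule (Fin 5) ℂ d ⊓
    (LinearMap.ker LPlus.toLinearMap ⊓ Module.End.eigenspace LZ.toLinearMap (j : ℂ))

end TetrahedralQuotient

end

/-!
The five coordinates of a point `p` are the coefficients of the binary quartic `V ∘ p`, so that the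
right action becomes linear substitution in quartics, highest weight vectors become leading
coefficients of covariants, and everything they do on the sphere is read off from the covariants of
the single form `V`. This form is equianharmonic: its apolar invariant vanishes, its catalecticant
does not, and its Hessian is a multiple of the conjugate form, which gives the quadratic relation,
the normalization and the reality conditions. It is the only quadratic relation because a
polynomial vanishing on the sphere vanishes on the whole orbit of `V` under linear substitutions.

The catalecticant shows that a scalar by which an element of `SU(2)` multiplies `V` is a cube root
of unity, and after division by a power of `genOmega` the element fixes `V` and its conjugate, hence
`s² t²`. So the stabilizer of the line of `V` is `Γ`, and the quotient embeds by compactness.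
The immersion property is checked at the identity, where the right action reduces it.

An invariant binary form is its own average, first over the quaternion group `⟨genI, genK⟩`, which
gives a polynomial in `V`, its conjugate and `P`, and then over `⟨genOmega⟩`, which selects the
monomials on which the character is trivial. For functions on the quotient, the lowering operator
produces all polynomials on the sphere from the forms in `s`, `t`, and it commutes with averaging
over `Γ`, so that it suffices to express `P`, `W` and `V³` by cubic forms in the coordinates.
-/

open MvPolynomial ComplexConjugate

noncomputable section

namespace TetrahedralQuotient

lemma ofReal_sqrt_three_sq : (Real.sqrt 3 : ℂ) ^ 2 = 3 := by
  norm_cast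
  exact Real.sq_sqrt zero_le_three

/-- The number `i / √3`: the coefficient of `s² t²` in `V` is `6 * mu`, in the normalization
`s⁴ + t⁴ + 6 m s² t²` that is usual for binary quartics. -/
def mu : ℂ := Complex.I * Real.sqrt 3 / 3

lemma six_mul_mu : 6 * mu = 2 * Complex.I * Real.sqrt 3 := by
  rw [mu]
  ring

lemma three_mul_mu_sq : 3 * mu ^ 2 = -1 := by
  rw [mu]
  linear_combination (Complex.I ^ 2 / 3) * ofReal_sqrt_three_sq + Complex.I_sq

lemma mu_ne_zero : mu ≠ 0 := by
  intro h
  simpa [h] using three_mul_mu_sq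

lemma conj_mu : conj mu = -mu := by
  rw [mu, map_div₀, map_mul, Complex.conj_I, Complex.conj_ofReal, Complex.conj_ofNat]
  ring

lemma C_six_mul_mu {σ : Type*} :
    (C (2 * Complex.I * Real.sqrt 3) : MvPolynomial σ ℂ) = 6 * C mu := by
  rw [← six_mul_mu, map_mul, map_ofNat]

lemma three_mul_C_mu_sq {σ : Type*} : 3 * C mu ^ 2 = (-1 : MvPolynomial σ ℂ) := by
  rw [← map_pow, ← map_ofNat C, ← map_mul, three_mul_mu_sq, map_neg, map_one]

/-! ### Binary quartics -/

/-- The coefficients `u l` of the quartic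
`x⁴ + y⁴ + 6 m x² y² = ∑ l, (4.choose l) * u l * X ^ (4 - l) * Y ^ l` after the substitution
`x = s X + b Y`, `y = t X + d Y`. For `m = mu` and `(s, t, b, d) = (s, t, -conj t, conj s)` they
are the coordinates `v_l`. -/
def binaryCoeff {A : Type*} [CommRing A] (m s t b d : A) : Fin 5 → A :=
  ![s ^ 4 + t ^ 4 + 6 * m * s ^ 2 * t ^ 2,
    s ^ 3 * b + t ^ 3 * d + 3 * m * (s * b * t ^ 2 + s ^ 2 * t * d),
    s ^ 2 * b ^ 2 + t ^ 2 * d ^ 2 + m * (b ^ 2 * t ^ 2 + 4 * s * b * t * d + s ^ 2 * d ^ 2),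
    s * b ^ 3 + t * d ^ 3 + 3 * m * (b ^ 2 * t * d + s * b * d ^ 2),
    b ^ 4 + d ^ 4 + 6 * m * b ^ 2 * d ^ 2]

/-- The spin 2 representation of `2 × 2` matrices: the action of the substitution
`X ↦ e X + f Y`, `Y ↦ g X + h Y` on the coefficients of binary quartics. -/
def substMatrix {A : Type*} [CommRing A] (e f g h : A) : Matrix (Fin 5) (Fin 5) A :=
  !![e ^ 4, 4 * e ^ 3 * g, 6 * e ^ 2 * g ^ 2, 4 * e * g ^ 3, g ^ 4;
    e ^ 3 * f, e ^ 3 * h + 3 * e ^ 2 * g * f, 3 * e ^ 2 * g * h + 3 * e * g ^ 2 * f,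
      3 * e * g ^ 2 * h + g ^ 3 * f, g ^ 3 * h;
    e ^ 2 * f ^ 2, 2 * e ^ 2 * f * h + 2 * e * g * f ^ 2,
      e ^ 2 * h ^ 2 + 4 * e * g * f * h + g ^ 2 * f ^ 2, 2 * e * g * h ^ 2 + 2 * g ^ 2 * f * h,
      g ^ 2 * h ^ 2;
    f ^ 3 * e, f ^ 3 * g + 3 * f ^ 2 * h * e, 3 * f ^ 2 * h * g + 3 * f * h ^ 2 * e,
      3 * f * h ^ 2 * g + h ^ 3 * e, h ^ 3 * g;
    f ^ 4, 4 * f ^ 3 * h, 6 * f ^ 2 * h ^ 2, 4 * f * h ^ 3, h ^ 4]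

section BinaryQuartic

variable {A : Type*} [CommRing A] (m s t b d : A)

lemma map_binaryCoeff {B : Type*} [CommRing B] (φ : A →+* B) (l : Fin 5) :
    φ (binaryCoeff m s t b d l) = binaryCoeff (φ m) (φ s) (φ t) (φ b) (φ d) l := by
  fin_cases l <;> simp [binaryCoeff, map_ofNat φ]

lemma binaryCoeff_mul (e f g h : A) :
    binaryCoeff m (s * e + b * g) (t * e + d * g) (s * f + b * h) (t * f + d * h) =
      (substMatrix e f g h).mulVec (binaryCoeff m s t b d) := by
  ext l
  fin_cases l <;>
    simp [binaryCoeff, substMatrix, Matrix.mulVec, dotProduct, Fin.sum_univ_five] <;> ring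

lemma binaryCoeff_reverse (l : Fin 5) :
    binaryCoeff m d (-b) (-t) s l = (-1) ^ (l : ℕ) * binaryCoeff m s t b d l.rev := by
  fin_cases l <;> simp [binaryCoeff, Fin.rev] <;> ring

end BinaryQuartic

/-- The apolar invariant of binary quartics. -/
def quadInvariant : MvPolynomial (Fin 5) ℂ := X 0 * X 4 - 4 * X 1 * X 3 + 3 * X 2 ^ 2

/-- The leading coefficient of the Hessian of a binary quartic. -/
def hessCovariant : MvPolynomial (Fin 5) ℂ := X 0 * X 2 - X 1 ^ 2

/-- The catalecticant of binary quartics. -/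
def cubicInvariant : MvPolynomial (Fin 5) ℂ :=
  X 0 * X 2 * X 4 + 2 * X 1 * X 2 * X 3 - X 2 ^ 3 - X 0 * X 3 ^ 2 - X 1 ^ 2 * X 4

/-- The leading coefficient of the Jacobian of a binary quartic and its Hessian. -/
def cubicCovariant : MvPolynomial (Fin 5) ℂ :=
  X 0 ^ 2 * X 3 - 3 * X 0 * X 1 * X 2 + 2 * X 1 ^ 3

section Covariants

variable {A : Type*} [CommRing A] [Algebra ℂ A] (m s t b d : A)

lemma aeval_binaryCoeff_quadInvariant :
    aeval (binaryCoeff m s t b d) quadInvariant = (1 + 3 * m ^ 2) * (s * d - t * b) ^ 4 := by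
  simp only [quadInvariant, map_add, map_sub, map_mul, map_pow, map_ofNat, aeval_X, binaryCoeff,
    Matrix.cons_val]
  ring

lemma aeval_binaryCoeff_hessCovariant :
    aeval (binaryCoeff m s t b d) hessCovariant =
      (s * d - t * b) ^ 2 * (m * (s ^ 4 + t ^ 4) + (1 - 3 * m ^ 2) * s ^ 2 * t ^ 2) := by
  simp only [hessCovariant, map_sub, map_mul, map_pow, aeval_X, binaryCoeff, Matrix.cons_val]
  ring

lemma aeval_binaryCoeff_cubicInvariant :
    aeval (binaryCoeff m s t b d) cubicInvariant = (m - m ^ 3) * (s * d - t * b) ^ 6 := by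
  simp only [cubicInvariant, map_add, map_sub, map_mul, map_pow, map_ofNat, aeval_X, binaryCoeff,
    Matrix.cons_val]
  ring

lemma aeval_binaryCoeff_cubicCovariant :
    aeval (binaryCoeff m s t b d) cubicCovariant =
      (1 - 9 * m ^ 2) * (s * d - t * b) ^ 3 * (s * t * (s ^ 4 - t ^ 4)) := by
  simp only [cubicCovariant, map_add, map_sub, map_mul, map_pow, map_ofNat, aeval_X, binaryCoeff,
    Matrix.cons_val]
  ring

end Covariants

/-! ### The multiplet on the sphere -/

lemma derivation_map_of_X {R σ τ : Type*} [CommSemiring R]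
    (D : Derivation R (MvPolynomial σ R) (MvPolynomial σ R))
    (E : Derivation R (MvPolynomial τ R) (MvPolynomial τ R))
    (φ : MvPolynomial σ R →ₐ[R] MvPolynomial τ R) (h : ∀ i, E (φ (X i)) = φ (D (X i)))
    (F : MvPolynomial σ R) : E (φ F) = φ (D F) := by
  induction F using MvPolynomial.induction_on with
  | C a => simp only [algHom_C, derivation_C, map_zero, algebraMap_eq]
  | add p q hp hq => simp only [map_add, hp, hq]
  | mul_X p i hp => simp only [map_mul, Derivation.leibniz, smul_eq_mul, map_add, hp, h]

@[simp]
lemma derivation_ofNat {R σ : Type*} [CommSemiring R]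
    (D : Derivation R (MvPolynomial σ R) (MvPolynomial σ R)) (n : ℕ) [n.AtLeastTwo] :
    D (ofNat(n) : MvPolynomial σ R) = 0 :=
  D.map_natCast n

/-- The coefficients of `(s X - conj t Y)⁴ + (t X + conj s Y)⁴ + 6 m (s X - conj t Y)²
(t X + conj s Y)²`, as polynomials in `s = X 0`, `t = X 1`, `conj s = X 2`, `conj t = X 3`. -/
def genericCoeff (m : ℂ) : Fin 5 → MvPolynomial (Fin 4) ℂ :=
  binaryCoeff (C m) (X 0) (X 1) (-X 3) (X 2)

section Multiplet

variable (m : ℂ)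

lemma JZ_genericCoeff (l : Fin 5) :
    JZ (genericCoeff m l) = aeval (genericCoeff m) (LZ (X l)) := by
  have half : 2 * C (1 / 2) = (1 : MvPolynomial (Fin 4) ℂ) := by
    rw [← map_ofNat C 2, ← map_mul, mul_one_div_cancel two_ne_zero, map_one]
  have h0 : JZ (X 0) = C (1 / 2) * X 0 := by simp [JZ]
  have h1 : JZ (X 1) = C (1 / 2) * X 1 := by simp [JZ]
  have h2 : JZ (X 2) = -(C (1 / 2) * X 2) := by simp [JZ]
  have h3 : JZ (X 3) = -(C (1 / 2) * X 3) := by simp [JZ]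
  fin_cases l <;>
    simp [genericCoeff, binaryCoeff, LZ, h0, h1, h2, h3, map_ofNat] <;>
    grind

lemma JPlus_genericCoeff (l : Fin 5) :
    JPlus (genericCoeff m l) = aeval (genericCoeff m) (LPlus (X l)) := by
  fin_cases l <;> simp [genericCoeff, binaryCoeff, JPlus, LPlus, map_ofNat] <;> ring

lemma JMinus_genericCoeff (l : Fin 5) :
    JMinus (genericCoeff m l) = aeval (genericCoeff m) (LMinus (X l)) := by
  fin_cases l <;> simp [genericCoeff, binaryCoeff, JMinus, LMinus, map_ofNat] <;> ring

lemma JMinus_aeval_genericCoeff (F : MvPolynomial (Fin 5) ℂ) :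
    JMinus (aeval (genericCoeff m) F) = aeval (genericCoeff m) (LMinus F) :=
  derivation_map_of_X LMinus JMinus _ (fun l => by rw [aeval_X, JMinus_genericCoeff]) F

end Multiplet

lemma eval_aeval {R σ τ : Type*} [CommSemiring R] (x : τ → R) (φ : σ → MvPolynomial τ R)
    (F : MvPolynomial σ R) : eval x (aeval φ F) = eval (fun i => eval x (φ i)) F :=
  comp_aeval_apply φ (aeval x) F

lemma eval_smul_of_isHomogeneous {R σ : Type*} [CommSemiring R] {n : ℕ} {F : MvPolynomial σ R}
    (hF : F.IsHomogeneous n) (a : R) (x : σ → R) : eval (a • x) F = a ^ n * eval x F := by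
  rw [eval_eq, eval_eq, Finset.mul_sum]
  refine Finset.sum_congr rfl fun m hm => ?_
  have degree_eq : ∑ i ∈ m.support, m i = n := by
    rw [← hF (mem_support_iff.1 hm), Finsupp.weight_apply, Finsupp.sum]
    simp only [Pi.one_apply, smul_eq_mul, mul_one]
  simp only [Pi.smul_apply, smul_eq_mul, mul_pow, Finset.prod_mul_distrib]
  rw [Finset.prod_pow_eq_pow_sum, degree_eq, mul_left_comm]

section Descendant

variable {A B : Type} [CommRing A] [Algebra ℂ A] [CommRing B] [Algebra ℂ B]

lemma descendant_smul (D : Derivation ℂ A A) (N l : ℕ) (a : ℂ) (f : A) :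
    descendant D N l (a • f) = a • descendant D N l f := by
  have iterate_smul : D^[l] (a • f) = a • D^[l] f :=
    Function.Commute.iterate_left (g := (a • ·)) (fun x => D.map_smul a x) l f
  rw [descendant, iterate_smul, smul_comm, descendant]

lemma descendant_mul_of_map_eq_zero (D : Derivation ℂ A A) (N l : ℕ) {c : A} (hc : D c = 0)
    (f : A) : descendant D N l (c * f) = c * descendant D N l f := by
  have map_c_mul (x : A) : D (c * x) = c * D x := by
    rw [D.leibniz, hc, smul_zero, add_zero, smul_eq_mul]
  have iterate_c_mul : D^[l] (c * f) = c * D^[l] f :=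
    Function.Commute.iterate_left (g := (c * ·)) map_c_mul l f
  rw [descendant, iterate_c_mul, ← mul_smul_comm, descendant]

lemma map_descendant {D : Derivation ℂ A A} {E : Derivation ℂ B B} {φ : A →ₐ[ℂ] B}
    (h : ∀ x, E (φ x) = φ (D x)) (N l : ℕ) (f : A) :
    φ (descendant D N l f) = descendant E N l (φ f) := by
  have map_iterate : φ (D^[l] f) = E^[l] (φ f) :=
    (Function.Semiconj.iterate_right (f := φ) (fun x => (h x).symm) l) f
  rw [descendant, map_smul, map_iterate, descendant]

end Descendant

lemma descendant_JMinus_genericCoeff (m : ℂ) (l : Fin 5) :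
    descendant JMinus 4 l (genericCoeff m 0) = genericCoeff m l := by
  have step0 : JMinus (genericCoeff m 0) = (4 : ℂ) • genericCoeff m 1 := by
    simp [JMinus_genericCoeff, LMinus, map_ofNat, smul_eq_C_mul]
  have step1 : JMinus (genericCoeff m 1) = (3 : ℂ) • genericCoeff m 2 := by
    simp [JMinus_genericCoeff, LMinus, map_ofNat, smul_eq_C_mul]
  have step2 : JMinus (genericCoeff m 2) = (2 : ℂ) • genericCoeff m 3 := by
    simp [JMinus_genericCoeff, LMinus, map_ofNat, smul_eq_C_mul]
  have step3 : JMinus (genericCoeff m 3) = genericCoeff m 4 := by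
    simp [JMinus_genericCoeff, LMinus]
  fin_cases l <;>
    norm_num [descendant, Nat.factorial, step0, step1, step2, step3, smul_smul] <;> rfl

/-- The inclusion of the binary forms in the polynomials in `s`, `t`, `conj s`, `conj t`. -/
def inclForm : MvPolynomial (Fin 2) ℂ →ₐ[ℂ] MvPolynomial (Fin 4) ℂ := rename ![0, 1]

/-- The polynomial `s * conj s + t * conj t`, which is `1` on the sphere. -/
def normForm : MvPolynomial (Fin 4) ℂ := X 0 * X 2 + X 1 * X 3

lemma inclForm_formV : inclForm formV = genericCoeff mu 0 := by
  rw [formV, C_six_mul_mu]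
  simp only [inclForm, map_add, map_mul, map_pow, map_ofNat, rename_X, rename_C, genericCoeff,
    binaryCoeff, Matrix.cons_val]

lemma inclForm_formVbar : inclForm formVbar = genericCoeff (-mu) 0 := by
  rw [formVbar, C_six_mul_mu]
  simp only [inclForm, map_add, map_sub, map_mul, map_pow, map_neg, map_ofNat, rename_X, rename_C,
    genericCoeff, binaryCoeff, Matrix.cons_val]
  ring

lemma multiplet_eq : multiplet = genericCoeff mu := by
  ext1 l
  rw [← descendant_JMinus_genericCoeff, ← inclForm_formV]
  rfl

lemma JMinus_normForm : JMinus normForm = 0 := by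
  simp only [normForm, JMinus, map_add, Derivation.leibniz, mkDerivation_X, Matrix.cons_val,
    smul_eq_mul]
  ring

lemma normForm_eq : (X 0 * X 2 - X 1 * -X 3 : MvPolynomial (Fin 4) ℂ) = normForm := by
  rw [mul_neg, sub_neg_eq_add, normForm]

lemma aeval_multiplet_quadInvariant : aeval multiplet quadInvariant = 0 := by
  rw [multiplet_eq, genericCoeff, aeval_binaryCoeff_quadInvariant, three_mul_C_mu_sq]
  ring

lemma aeval_multiplet_hessCovariant :
    aeval multiplet hessCovariant = C mu * normForm ^ 2 * inclForm formVbar := by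
  rw [multiplet_eq, inclForm_formVbar, genericCoeff, aeval_binaryCoeff_hessCovariant, normForm_eq,
    three_mul_C_mu_sq]
  simp only [genericCoeff, binaryCoeff, Matrix.cons_val, map_neg]
  linear_combination 2 * normForm ^ 2 * X 0 ^ 2 * X 1 ^ 2 * three_mul_C_mu_sq (σ := Fin 4)

lemma aeval_multiplet_cubicInvariant :
    aeval multiplet cubicInvariant = C (4 / 3 * mu) * normForm ^ 6 := by
  rw [multiplet_eq, genericCoeff, aeval_binaryCoeff_cubicInvariant, normForm_eq, ← map_pow,
    ← map_sub]
  congr 2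
  linear_combination (-mu / 3) * three_mul_mu_sq

lemma aeval_multiplet_cubicCovariant :
    aeval multiplet cubicCovariant = 4 * normForm ^ 3 * inclForm formP := by
  have formP_eq : inclForm formP = X 0 * X 1 * (X 0 ^ 4 - X 1 ^ 4) := by
    simp only [inclForm, formP, map_sub, map_mul, map_pow, rename_X, Matrix.cons_val]
  rw [multiplet_eq, formP_eq, genericCoeff, aeval_binaryCoeff_cubicCovariant, normForm_eq]
  linear_combination (-3 * normForm ^ 3 * (X 0 * X 1 * (X 0 ^ 4 - X 1 ^ 4))) *
    three_mul_C_mu_sq (σ := Fin 4)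

lemma aeval_multiplet_descendant_hessCovariant (l : Fin 5) :
    aeval multiplet (descendant LMinus 4 l hessCovariant) =
      C mu * normForm ^ 2 * genericCoeff (-mu) l := by
  have map_eq_zero : JMinus (C mu * normForm ^ 2) = 0 := by
    rw [← smul_eq_C_mul, Derivation.map_smul, Derivation.leibniz_pow, JMinus_normForm, smul_zero,
      smul_zero, smul_zero]
  rw [multiplet_eq, map_descendant (JMinus_aeval_genericCoeff mu), ← multiplet_eq,
    aeval_multiplet_hessCovariant, descendant_mul_of_map_eq_zero _ _ _ map_eq_zero,
    inclForm_formVbar, descendant_JMinus_genericCoeff]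

lemma formV_mul_formVbar : formV * formVbar = formW := by
  rw [formV, formVbar, formW, C_six_mul_mu]
  linear_combination (-12 * X 0 ^ 4 * X 1 ^ 4) * three_mul_C_mu_sq (σ := Fin 2)

/-! ### Points of the sphere -/

section Sphere

variable (p g : SU2)

lemma SU2.star_eq_adjugate : star p.1 = p.1.adjugate := by
  obtain ⟨unitary, det_eq⟩ := Matrix.mem_specialUnitaryGroup_iff.1 p.2
  calc star p.1 = (p.1.adjugate * p.1) * star p.1 := by
        rw [Matrix.adjugate_mul, det_eq, one_smul, one_mul]
    _ = p.1.adjugate := by rw [mul_assoc, Matrix.mem_unitaryGroup_iff.1 unitary, mul_one]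

lemma SU2.apply_zero_one : p.1 0 1 = -conj (p.1 1 0) := by
  have h := congrFun₂ p.star_eq_adjugate 0 1
  rw [Matrix.adjugate_fin_two, Matrix.star_apply] at h
  exact (neg_eq_iff_eq_neg.2 h).symm

lemma SU2.apply_one_one : p.1 1 1 = conj (p.1 0 0) := by
  have h := congrFun₂ p.star_eq_adjugate 0 0
  rw [Matrix.adjugate_fin_two, Matrix.star_apply] at h
  exact h.symm

lemma SU2.det_eq : p.1 0 0 * p.1 1 1 - p.1 1 0 * p.1 0 1 = 1 := by
  rw [mul_comm (p.1 1 0), ← Matrix.det_fin_two]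
  exact (Matrix.mem_specialUnitaryGroup_iff.1 p.2).2

lemma SU2.normSq_eq : p.1 0 0 * conj (p.1 0 0) + p.1 1 0 * conj (p.1 1 0) = 1 := by
  linear_combination p.det_eq - p.1 0 0 * p.apply_one_one + p.1 1 0 * p.apply_zero_one

variable {p g} in
lemma SU2.ext_column (h0 : p.1 0 0 = g.1 0 0) (h1 : p.1 1 0 = g.1 1 0) : p = g := by
  apply Subtype.ext
  rw [Matrix.eta_fin_two p.1, Matrix.eta_fin_two g.1, p.apply_zero_one, p.apply_one_one,
    g.apply_zero_one, g.apply_one_one, h0, h1]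

/-- The point of the sphere with first column `(s, t)`. -/
def SU2.mk (s t : ℂ) (h : s * conj s + t * conj t = 1) : SU2 :=
  ⟨!![s, -conj t; t, conj s], by
    rw [Matrix.mem_specialUnitaryGroup_iff, Matrix.mem_unitaryGroup_iff]
    constructor
    · ext i j
      fin_cases i <;> fin_cases j <;> simp [Matrix.mul_apply] <;> grind
    · rw [Matrix.det_fin_two_of, ← h]
      ring⟩

/-- The values of `s`, `t`, `conj s`, `conj t` at a point of the sphere. -/
def spherePoint : Fin 4 → ℂ := ![p.1 0 0, p.1 1 0, conj (p.1 0 0), conj (p.1 1 0)]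

lemma eval_spherePoint_normForm : eval (spherePoint p) normForm = 1 := by
  rw [← p.normSq_eq]
  simp [normForm, spherePoint]

lemma eval_spherePoint_inclForm (f : MvPolynomial (Fin 2) ℂ) :
    eval (spherePoint p) (inclForm f) = eval (st p) f := by
  rw [inclForm, eval_rename]
  congr 2
  ext i
  fin_cases i <;> rfl

lemma eval_spherePoint_aeval_multiplet (F : MvPolynomial (Fin 5) ℂ) :
    eval (spherePoint p) (aeval multiplet F) = eval (coord p) F :=
  eval_aeval _ _ F

lemma eval_spherePoint_genericCoeff (m : ℂ) (l : Fin 5) :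
    eval (spherePoint p) (genericCoeff m l) =
      binaryCoeff m (p.1 0 0) (p.1 1 0) (p.1 0 1) (p.1 1 1) l := by
  rw [genericCoeff, map_binaryCoeff, p.apply_zero_one, p.apply_one_one]
  simp [spherePoint]

lemma coordAt_eq (s t : ℂ) : coordAt (s, t) = binaryCoeff mu s t (-conj t) (conj s) := by
  ext l
  rw [coordAt, multiplet_eq, genericCoeff, map_binaryCoeff]
  simp

lemma coord_eq : coord p = binaryCoeff mu (p.1 0 0) (p.1 1 0) (p.1 0 1) (p.1 1 1) := by
  rw [coord, coordAt_eq, p.apply_zero_one, p.apply_one_one]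

lemma coord_mul : coord (p * g) =
    (substMatrix (g.1 0 0) (g.1 0 1) (g.1 1 0) (g.1 1 1)).mulVec (coord p) := by
  simp only [coord_eq, ← binaryCoeff_mul, Submonoid.coe_mul, Matrix.mul_apply, Fin.sum_univ_two]

lemma coord_one : coord 1 = ![1, 0, mu, 0, 1] := by
  rw [coord_eq]
  ext l
  fin_cases l <;> simp [binaryCoeff]

end Sphere

/-! ### The character of the tetrahedral group -/

/-- The primitive cube root of unity by which `genOmega` acts on `V`. -/
def zeta : ℂ := -(1 + 3 * mu) / 2

lemma zeta_sq_add_zeta_add_one : zeta ^ 2 + zeta + 1 = 0 := by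
  rw [zeta]
  linear_combination (3 / 4) * three_mul_mu_sq

lemma zeta_pow_three : zeta ^ 3 = 1 := by
  linear_combination (zeta - 1) * zeta_sq_add_zeta_add_one

lemma zeta_ne_one : zeta ≠ 1 := by
  intro h
  have := zeta_sq_add_zeta_add_one
  norm_num [h] at this

lemma isPrimitiveRoot_zeta : IsPrimitiveRoot zeta 3 :=
  IsPrimitiveRoot.iff_orderOf.2 (orderOf_eq_prime zeta_pow_three zeta_ne_one)

lemma coord_apply_zero (p : SU2) : coord p 0 = eval (st p) formV := by
  rw [coord_eq, ← eval_spherePoint_genericCoeff, ← inclForm_formV, eval_spherePoint_inclForm]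

lemma coord_one_zero : coord 1 0 = 1 := by
  rw [coord_one, Matrix.cons_val_zero]

lemma coord_genI : coord genI = coord 1 := by
  rw [coord_one, coord_eq]
  ext l
  fin_cases l <;> simp [binaryCoeff, genI, Complex.I_pow_four, Even.neg_pow (show Even 4 by decide)]

lemma coord_genOmega : coord genOmega = zeta • coord 1 := by
  have I_pow_four := Complex.I_pow_four
  have three_mul_mu_sq := three_mul_mu_sq
  rw [coord_one, coord_eq]
  ext l
  fin_cases l <;> simp [binaryCoeff, genOmega, zeta] <;> grind [Complex.I_sq]

lemma coord_mul_of_coord_eq {g : SU2} {c : ℂ} (hg : coord g = c • coord 1) (p : SU2) :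
    coord (g * p) = c • coord p := by
  rw [coord_mul, hg, Matrix.mulVec_smul, ← coord_mul, one_mul]

lemma exists_coord_eq_smul {g : SU2} (hg : g ∈ tetra) :
    ∃ c : ℂ, c ^ 3 = 1 ∧ coord g = c • coord 1 := by
  induction hg using Subgroup.closure_induction with
  | mem x hx =>
    rcases hx with rfl | rfl
    · exact ⟨1, one_pow 3, by rw [coord_genI, one_smul]⟩
    · exact ⟨zeta, zeta_pow_three, coord_genOmega⟩
  | one => exact ⟨1, one_pow 3, (one_smul _ _).symm⟩
  | mul x y _ _ hx hy =>
    obtain ⟨c, hc, hx⟩ := hx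
    obtain ⟨e, he, hy⟩ := hy
    exact ⟨c * e, by rw [mul_pow, hc, he, one_mul], by
      rw [coord_mul_of_coord_eq hx, hy, smul_smul]⟩
  | inv x _ hx =>
    obtain ⟨c, hc, hx⟩ := hx
    have c_ne_zero : c ≠ 0 := ne_zero_pow three_ne_zero (hc.trans_ne one_ne_zero)
    have coord_inv := coord_mul_of_coord_eq hx x⁻¹
    rw [mul_inv_cancel] at coord_inv
    exact ⟨c⁻¹, by rw [inv_pow, hc, inv_one], by
      rw [coord_inv, smul_smul, inv_mul_cancel₀ c_ne_zero, one_smul]⟩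

lemma eq_coord_apply_zero {g : SU2} {c : ℂ} (h : coord g = c • coord 1) : c = coord g 0 := by
  rw [h, Pi.smul_apply, coord_one_zero, smul_eq_mul, mul_one]

lemma coord_eq_apply_zero_smul {g : SU2} (hg : g ∈ tetra) : coord g = coord g 0 • coord 1 := by
  obtain ⟨c, -, h⟩ := exists_coord_eq_smul hg
  exact eq_coord_apply_zero h ▸ h

lemma coord_apply_zero_pow_three {g : SU2} (hg : g ∈ tetra) : coord g 0 ^ 3 = 1 := by
  obtain ⟨c, hc, h⟩ := exists_coord_eq_smul hg
  exact eq_coord_apply_zero h ▸ hc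

lemma coord_mul_of_mem {g : SU2} (hg : g ∈ tetra) (p : SU2) :
    coord (g * p) = coord g 0 • coord p :=
  coord_mul_of_coord_eq (coord_eq_apply_zero_smul hg) p

/-- The character by which the tetrahedral group acts on `V`. -/
def tetraChar : tetra →* ℂˣ :=
  MonoidHom.toHomUnits
    { toFun := fun g => coord g.1 0
      map_one' := coord_one_zero
      map_mul' := fun g h => congrFun (coord_mul_of_mem g.2 h.1) 0 }

lemma coe_tetraChar (g : tetra) : (tetraChar g : ℂ) = coord g.1 0 := rfl

lemma genI_mem : genI ∈ tetra := Subgroup.subset_closure (Set.mem_insert _ _)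

lemma genOmega_mem : genOmega ∈ tetra :=
  Subgroup.subset_closure (Set.mem_insert_of_mem _ (Set.mem_singleton _))

lemma tetraChar_ne_one : tetraChar ≠ 1 := by
  intro h
  apply zeta_ne_one
  rw [eq_coord_apply_zero coord_genOmega, ← coe_tetraChar ⟨genOmega, genOmega_mem⟩, h,
    MonoidHom.one_apply, Units.val_one]

lemma tetraChar_pow_three (g : tetra) : tetraChar g ^ 3 = 1 :=
  Units.ext (coord_apply_zero_pow_three g.2)

lemma binaryCoeff_apply_zero (x : Fin 2 → ℂ) (b d : ℂ) :
    binaryCoeff mu (x 0) (x 1) b d 0 = eval x formV := by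
  simp [binaryCoeff, formV, six_mul_mu]

lemma eval_formV_mulVec (g : tetra) (x : Fin 2 → ℂ) :
    eval (g.1.1.mulVec x) formV = tetraChar g * eval x formV := by
  have apply_zero (p : SU2) :
      (substMatrix (x 0) 0 (x 1) 0).mulVec (coord p) 0 = eval (p.1.mulVec x) formV := by
    rw [coord_eq, ← binaryCoeff_mul, ← binaryCoeff_apply_zero _ 0 0]
    simp [Matrix.mulVec, dotProduct, Fin.sum_univ_two, binaryCoeff]
  calc eval (g.1.1.mulVec x) formV = (substMatrix (x 0) 0 (x 1) 0).mulVec (coord g.1) 0 :=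
        (apply_zero g.1).symm
    _ = coord g.1 0 * (substMatrix (x 0) 0 (x 1) 0).mulVec (coord 1) 0 := by
        rw [coord_eq_apply_zero_smul g.2, Matrix.mulVec_smul, Pi.smul_apply, smul_eq_mul,
          Pi.smul_apply, coord_one_zero, smul_eq_mul, mul_one]
    _ = tetraChar g * eval x formV := by
        rw [apply_zero, coe_tetraChar, OneMemClass.coe_one, Matrix.one_mulVec]

/-! ### The stabilizer of the form `V` up to scalars -/

/-- An element of order four of the tetrahedral group which, unlike `genI`, exchanges the two
coordinate axes. -/
def genK : SU2 := SU2.mk 0 Complex.I (by simp)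

lemma genK_mem : genK ∈ tetra := by
  have conjugation : genK = genOmega * genI * genOmega⁻¹ := by
    rw [eq_mul_inv_iff_mul_eq]
    apply SU2.ext_column <;> simp [genK, SU2.mk, genOmega, genI] <;> ring
  rw [conjugation]
  exact mul_mem (mul_mem genOmega_mem genI_mem) (inv_mem genOmega_mem)

lemma genI_pow (k : ℕ) : genI.1 ^ k = Matrix.diagonal (![Complex.I, -Complex.I] ^ k) := by
  rw [← Matrix.diagonal_pow]
  congr 1
  ext i j
  fin_cases i <;> fin_cases j <;> simp [genI]

lemma isPrimitiveRoot_I : IsPrimitiveRoot Complex.I 4 :=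
  IsPrimitiveRoot.mk_of_lt Complex.I four_pos Complex.I_pow_four fun l hl0 hl => by
    interval_cases l <;> norm_num [Complex.ext_iff, Complex.I_pow_three]

lemma exists_eq_of_coord_eq_coord_one {g : SU2} (hg : coord g = coord 1) :
    ∃ k < 4, ∃ e < 2, g = genI ^ k * genK ^ e := by
  have h0 : g.1 0 0 ^ 4 + g.1 1 0 ^ 4 + 6 * mu * g.1 0 0 ^ 2 * g.1 1 0 ^ 2 = 1 := by
    simpa [coord_one, coord_eq, binaryCoeff] using congrFun hg 0
  have h4 : g.1 1 0 ^ 4 + g.1 0 0 ^ 4 - 6 * mu * g.1 1 0 ^ 2 * g.1 0 0 ^ 2 = 1 := by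
    have := congrArg conj (congrFun hg 4)
    simpa [coord_one, coord_eq, binaryCoeff, g.apply_zero_one, g.apply_one_one, conj_mu,
      map_ofNat (starRingEnd ℂ), sub_eq_add_neg, Even.neg_pow (show Even 4 by decide)] using this
  have mul_eq : mu * (g.1 0 0 * g.1 1 0) ^ 2 = 0 := by linear_combination (h0 - h4) / 12
  have product_eq_zero : g.1 0 0 * g.1 1 0 = 0 := by simpa [mu_ne_zero] using mul_eq
  rcases mul_eq_zero.1 product_eq_zero with hs | ht
  · have pow_four : (Complex.I * conj (g.1 1 0)) ^ 4 = 1 := by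
      rw [mul_pow, Complex.I_pow_four, one_mul, ← map_pow]
      have : g.1 1 0 ^ 4 = 1 := by simpa [hs] using h0
      rw [this, map_one]
    obtain ⟨k, hk, I_pow⟩ := isPrimitiveRoot_I.eq_pow_of_pow_eq_one pow_four
    have neg_I_pow : (-Complex.I) ^ k = -Complex.I * g.1 1 0 := by
      simpa using congrArg conj I_pow
    refine ⟨k, hk, 1, one_lt_two, SU2.ext_column ?_ ?_⟩
    · simp [genI_pow, genK, SU2.mk, hs]
    · simp [genI_pow, genK, SU2.mk, neg_I_pow, mul_right_comm]
  · obtain ⟨k, hk, I_pow⟩ := isPrimitiveRoot_I.eq_pow_of_pow_eq_one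
      (show g.1 0 0 ^ 4 = 1 by simpa [ht] using h0)
    exact ⟨k, hk, 0, two_pos, SU2.ext_column (by simp [genI_pow, I_pow]) (by simp [genI_pow, ht])⟩

lemma eval_coord_cubicInvariant (p : SU2) : eval (coord p) cubicInvariant = 4 / 3 * mu := by
  rw [← eval_spherePoint_aeval_multiplet, aeval_multiplet_cubicInvariant, map_mul, map_pow,
    eval_spherePoint_normForm, eval_C, one_pow, mul_one]

lemma isHomogeneous_ofNat_mul {R σ : Type*} [CommSemiring R] {n : ℕ} {F : MvPolynomial σ R}
    (hF : F.IsHomogeneous n) (k : ℕ) [k.AtLeastTwo] :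
    (ofNat(k) * F : MvPolynomial σ R).IsHomogeneous n := by
  rw [← map_ofNat C]
  exact hF.C_mul _

lemma isHomogeneous_cubicInvariant : cubicInvariant.IsHomogeneous 3 := by
  have mul_three (i j k : Fin 5) : (X i * X j * X k : MvPolynomial (Fin 5) ℂ).IsHomogeneous 3 :=
    ((isHomogeneous_X ℂ i).mul (isHomogeneous_X ℂ j)).mul (isHomogeneous_X ℂ k)
  rw [cubicInvariant, mul_assoc 2, mul_assoc 2]
  exact ((((mul_three 0 2 4).add (isHomogeneous_ofNat_mul (mul_three 1 2 3) 2)).sub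
    (isHomogeneous_X_pow 2 3)).sub ((isHomogeneous_X ℂ 0).mul (isHomogeneous_X_pow 3 2))).sub
    ((isHomogeneous_X_pow 1 2).mul (isHomogeneous_X ℂ 4))

lemma pow_three_eq_one_of_coord_eq_smul {p q : SU2} {c : ℂ} (h : coord p = c • coord q) :
    c ^ 3 = 1 := by
  have eval_eq := eval_smul_of_isHomogeneous isHomogeneous_cubicInvariant c (coord q)
  rw [← h, eval_coord_cubicInvariant, eval_coord_cubicInvariant] at eval_eq
  exact (mul_eq_right₀ (mul_ne_zero (by norm_num) mu_ne_zero)).1 eval_eq.symm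

lemma exists_eq_of_coord_eq_smul {g : SU2} {c : ℂ} (hg : coord g = c • coord 1) :
    ∃ n < 3, ∃ k < 4, ∃ e < 2, g = genOmega ^ n * (genI ^ k * genK ^ e) := by
  obtain ⟨n, hn, rfl⟩ := isPrimitiveRoot_zeta.eq_pow_of_pow_eq_one
    (pow_three_eq_one_of_coord_eq_smul hg)
  have coord_pow (j : ℕ) : coord (genOmega ^ j) = zeta ^ j • coord 1 := by
    induction j with
    | zero => rw [pow_zero, pow_zero, one_smul]
    | succ j ih => rw [pow_succ, coord_mul_of_coord_eq ih, coord_genOmega, smul_smul, pow_succ]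
  have h := coord_mul_of_coord_eq (coord_pow n) ((genOmega ^ n)⁻¹ * g)
  rw [mul_inv_cancel_left, hg] at h
  obtain ⟨k, hk, e, he, eq⟩ := exists_eq_of_coord_eq_coord_one
    (smul_right_injective _ (pow_ne_zero n (isPrimitiveRoot_zeta.ne_zero three_ne_zero)) h).symm
  exact ⟨n, hn, k, hk, e, he, by rw [← eq, mul_inv_cancel_left]⟩

lemma mem_tetra_of_coord_eq_smul {g : SU2} {c : ℂ} (hg : coord g = c • coord 1) : g ∈ tetra := by
  obtain ⟨n, -, k, -, e, -, rfl⟩ := exists_eq_of_coord_eq_smul hg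
  exact mul_mem (pow_mem genOmega_mem _) (mul_mem (pow_mem genI_mem _) (pow_mem genK_mem _))

instance finite_tetra : Finite tetra := by
  let words := (Set.Iio 3 ×ˢ Set.Iio 4 ×ˢ Set.Iio 2).image fun x : ℕ × ℕ × ℕ =>
    genOmega ^ x.1 * (genI ^ x.2.1 * genK ^ x.2.2)
  have words_finite : words.Finite :=
    ((Set.finite_Iio 3).prod ((Set.finite_Iio 4).prod (Set.finite_Iio 2))).image _
  refine words_finite.subset fun g hg => ?_
  obtain ⟨n, hn, k, hk, e, he, h⟩ := exists_eq_of_coord_eq_smul (coord_eq_apply_zero_smul hg)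
  exact ⟨(n, k, e), ⟨hn, hk, he⟩, h.symm⟩

/-! ### The embedding -/

lemma coord_ne_zero (p : SU2) : coord p ≠ 0 := by
  intro h
  have coord_one_eq := coord_mul p p⁻¹
  rw [mul_inv_cancel, h, Matrix.mulVec_zero] at coord_one_eq
  exact one_ne_zero (coord_one_zero.symm.trans (congrFun coord_one_eq 0))

lemma mul_inv_mem_of_coord_eq_smul {p q : SU2} {c : ℂ} (h : coord p = c • coord q) :
    p * q⁻¹ ∈ tetra := by
  apply mem_tetra_of_coord_eq_smul (c := c)
  rw [coord_mul, h, Matrix.mulVec_smul, ← coord_mul, mul_inv_cancel]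

lemma proj_eq_proj_iff (p q : SU2) : proj p = proj q ↔ ∃ g : tetra, g.1 * q = p := by
  rw [proj, proj, Quotient.eq]
  rfl

lemma continuous_coord : Continuous coord := by
  have continuous_entry (i j : Fin 2) : Continuous fun p : SU2 => p.1 i j :=
    (continuous_apply_apply i j).comp continuous_subtype_val
  have continuous_binaryCoeff :
      Continuous fun x : ℂ × ℂ × ℂ × ℂ => binaryCoeff mu x.1 x.2.1 x.2.2.1 x.2.2.2 := by
    refine continuous_pi fun l => ?_
    fin_cases l <;> simp only [binaryCoeff, Fin.reduceFinMk, Matrix.cons_val] <;> fun_prop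
  exact (continuous_binaryCoeff.comp ((continuous_entry 0 0).prodMk ((continuous_entry 1 0).prodMk
    ((continuous_entry 0 1).prodMk (continuous_entry 1 1))))).congr fun p => (coord_eq p).symm

instance compactSpace_SU2 : CompactSpace SU2 := by
  have isCompact_entries : IsCompact (Set.pi Set.univ fun _ : Fin 2 =>
      Set.pi Set.univ fun _ : Fin 2 => Metric.closedBall (0 : ℂ) 1) :=
    isCompact_univ_pi fun _ => isCompact_univ_pi fun _ => isCompact_closedBall _ _
  have eq_inter : (Matrix.specialUnitaryGroup (Fin 2) ℂ : Set (Matrix (Fin 2) (Fin 2) ℂ)) =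
      {A | A * star A = 1} ∩ {A | A.det = 1} := by
    ext A
    exact Matrix.mem_specialUnitaryGroup_iff.trans
      (and_congr_left fun _ => Matrix.mem_unitaryGroup_iff)
  have isClosed_specialUnitaryGroup :
      IsClosed (Matrix.specialUnitaryGroup (Fin 2) ℂ : Set (Matrix (Fin 2) (Fin 2) ℂ)) := by
    rw [eq_inter]
    exact (isClosed_eq (by fun_prop) continuous_const).inter
      (isClosed_eq (by fun_prop) continuous_const)
  refine isCompact_iff_compactSpace.1
    (isCompact_entries.of_isClosed_subset isClosed_specialUnitaryGroup ?_)
  intro A hA i _ j _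
  rw [mem_closedBall_zero_iff]
  exact entry_norm_bound_of_unitary (Matrix.mem_specialUnitaryGroup_iff.1 hA).1 i j

section Projector

open Matrix
open scoped ComplexOrder

variable {ι : Type*} [Fintype ι] {x : ι → ℂ}

/-- The matrix of the orthogonal projection to the line spanned by a nonzero vector `x`; it
separates the points of the projective space. -/
def projector (x : ι → ℂ) : Matrix ι ι ℂ := (star x ⬝ᵥ x)⁻¹ • vecMulVec x (star x)

lemma star_dotProduct_self_ne_zero (hx : x ≠ 0) : star x ⬝ᵥ x ≠ 0 :=
  mt dotProduct_star_self_eq_zero.1 hx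

lemma projector_smul {c : ℂ} (hc : c ≠ 0) (x : ι → ℂ) : projector (c • x) = projector x := by
  have star_c_ne_zero : star c ≠ 0 := star_ne_zero.2 hc
  simp only [projector, star_smul, smul_dotProduct, dotProduct_smul, smul_vecMulVec,
    vecMulVec_smul, smul_eq_mul, smul_smul]
  congr 1
  field_simp

lemma projector_mulVec (x y : ι → ℂ) :
    projector x *ᵥ y = ((star x ⬝ᵥ x)⁻¹ * (star x ⬝ᵥ y)) • x := by
  rw [projector, smul_mulVec, vecMulVec_mulVec, op_smul_eq_smul, smul_smul]

lemma projector_mulVec_self (hx : x ≠ 0) : projector x *ᵥ x = x := by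
  rw [projector_mulVec, inv_mul_cancel₀ (star_dotProduct_self_ne_zero hx), one_smul]

end Projector

instance t2Space_projectivization : T2Space (Projectivization ℂ (Fin 5 → ℂ)) := by
  let f : Projectivization ℂ (Fin 5 → ℂ) → Matrix (Fin 5) (Fin 5) ℂ :=
    Projectivization.lift (fun x => projector x.1) fun x y c h => by
      have c_ne_zero : c ≠ 0 := by
        rintro rfl
        exact x.2 (h.trans (zero_smul ℂ y.1))
      rw [h, projector_smul c_ne_zero]
  have continuous_f : Continuous f := by
    rw [continuous_coinduced_dom]
    exact ((by fun_prop : Continuous fun x : {x : Fin 5 → ℂ // x ≠ 0} => star x.1 ⬝ᵥ x.1).inv₀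
      fun x => star_dotProduct_self_ne_zero x.2).smul (by fun_prop)
  refine T2Space.of_injective_continuous (f := f) ?_ continuous_f
  intro a b
  induction a using Projectivization.ind with | h x hx => ?_
  induction b using Projectivization.ind with | h y hy => ?_
  intro projector_eq
  change projector x = projector y at projector_eq
  rw [Projectivization.mk_eq_mk_iff']
  exact ⟨_, by rw [← projector_mulVec, ← projector_eq, projector_mulVec_self hx]⟩

/-- The map from the quotient to the projective space given by the five coordinates. -/
def quotientCoord : Quot3 → Projectivization ℂ (Fin 5 → ℂ) :=
  Quotient.lift (fun p => Projectivization.mk ℂ (coord p) (coord_ne_zero p)) <| by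
    rintro p q ⟨g, rfl⟩
    exact (Projectivization.mk_eq_mk_iff' ..).2 ⟨coord g.1 0, (coord_mul_of_mem g.2 q).symm⟩

lemma continuous_quotientCoord : Continuous quotientCoord := by
  have continuous_mk : Continuous fun x : {x : Fin 5 → ℂ // x ≠ 0} =>
      Projectivization.mk ℂ x.1 x.2 :=
    continuous_coinduced_rng
  exact (continuous_mk.comp (continuous_coord.subtype_mk coord_ne_zero)).quotient_lift _

lemma quotientCoord_injective : Function.Injective quotientCoord := by
  intro a b h
  induction a using Quotient.inductionOn with | h p => ?_
  induction b using Quotient.inductionOn with | h q => ?_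
  obtain ⟨c, hc⟩ := (Projectivization.mk_eq_mk_iff' ..).1 h
  exact (proj_eq_proj_iff p q).2
    ⟨⟨_, mul_inv_mem_of_coord_eq_smul hc.symm⟩, inv_mul_cancel_right p q⟩

lemma isEmbedding_quotientCoord : Topology.IsEmbedding quotientCoord := by
  have : CompactSpace Quot3 := Quotient.compactSpace
  exact (continuous_quotientCoord.isClosedEmbedding quotientCoord_injective).isEmbedding

/-! ### The immersion -/

lemma differentiable_coordAt : Differentiable ℝ coordAt := by
  have _conj_fst : Differentiable ℝ fun x : ℂ × ℂ => conj x.1 :=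
    Complex.conjCLE.differentiable.comp differentiable_fst
  have _conj_snd : Differentiable ℝ fun x : ℂ × ℂ => conj x.2 :=
    Complex.conjCLE.differentiable.comp differentiable_snd
  have coordAt_eq_fun :
      coordAt = fun x : ℂ × ℂ => binaryCoeff mu x.1 x.2 (-conj x.2) (conj x.1) :=
    funext fun x => coordAt_eq x.1 x.2
  rw [coordAt_eq_fun, differentiable_pi]
  intro l
  fin_cases l <;> simp only [binaryCoeff, Fin.reduceFinMk, Matrix.cons_val] <;> fun_prop

lemma coordAt_mul (g : SU2) (x : ℂ × ℂ) :
    coordAt (x.1 * g.1 0 0 - conj x.2 * g.1 1 0, x.2 * g.1 0 0 + conj x.1 * g.1 1 0) =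
      (substMatrix (g.1 0 0) (g.1 0 1) (g.1 1 0) (g.1 1 1)).mulVec (coordAt x) := by
  rw [coordAt_eq, coordAt_eq, ← binaryCoeff_mul, g.apply_zero_one, g.apply_one_one]
  congr 1
  · ring
  · simp only [map_add, map_mul, Complex.conj_conj]
    ring
  · simp only [map_sub, map_mul, Complex.conj_conj]
    ring

lemma hasLineDerivAt_mulVec {E m n : Type*} [NormedAddCommGroup E] [NormedSpace ℝ E] [Fintype m]
    [Fintype n] (A : Matrix m n ℂ) {f : E → n → ℂ} {v : n → ℂ} {x w : E}
    (h : HasLineDerivAt ℝ f v x w) :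
    HasLineDerivAt ℝ (fun y => A.mulVec (f y)) (A.mulVec v) x w :=
  (A.mulVecLin.restrictScalars ℝ).toContinuousLinearMap.hasFDerivAt.comp_hasDerivAt 0 h

lemma hasLineDerivAt_coordAt_mul {v : Fin 5 → ℂ} {x w : ℂ × ℂ} (g : SU2)
    (h : HasLineDerivAt ℝ coordAt v x w) :
    HasLineDerivAt ℝ coordAt
      ((substMatrix (g.1 0 0) (g.1 0 1) (g.1 1 0) (g.1 1 1)).mulVec v)
      (x.1 * g.1 0 0 - conj x.2 * g.1 1 0, x.2 * g.1 0 0 + conj x.1 * g.1 1 0)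
      (w.1 * g.1 0 0 - conj w.2 * g.1 1 0, w.2 * g.1 0 0 + conj w.1 * g.1 1 0) := by
  refine HasDerivAt.congr_of_eventuallyEq (hasLineDerivAt_mulVec _ h)
    (Filter.Eventually.of_forall fun r => ?_)
  beta_reduce
  rw [← coordAt_mul]
  congr 1
  ext <;> simp only [Prod.fst_add, Prod.snd_add, Prod.smul_fst, Prod.smul_snd, Complex.real_smul,
    map_add, map_mul, Complex.conj_ofReal] <;> ring

lemma hasLineDerivAt_coordAt_one {v : Fin 5 → ℂ} {α β : ℂ}
    (h : HasLineDerivAt ℝ coordAt v (1, 0) (α, β)) :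
    v 0 = 4 * α ∧ v 1 = 3 * mu * β - conj β ∧ v 2 = 2 * mu * (α + conj α) := by
  have line (z w : ℂ) : HasDerivAt (fun r : ℝ => z + r * w) w 0 := by
    simpa using ((Complex.ofRealCLM.hasDerivAt (x := 0)).mul_const w).const_add z
  have hs := line 1 α
  have ht := line 0 β
  have hb := line 0 (-conj β)
  have hd := line 1 (conj α)
  have coordAt_line (l : Fin 5) : HasDerivAt (fun r : ℝ => binaryCoeff mu (1 + r * α) (0 + r * β)
      (0 + r * -conj β) (1 + r * conj α) l) (v l) 0 := by
    refine (hasDerivAt_pi.1 h l).congr_of_eventuallyEq (Filter.Eventually.of_forall fun r => ?_)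
    simp [coordAt_eq]
  refine ⟨?_, ?_, ?_⟩
  · refine (coordAt_line 0).unique (((((hs.pow 4).add (ht.pow 4)).add
      (((hs.pow 2).const_mul (6 * mu)).mul (ht.pow 2)))).congr_deriv ?_)
    simp
  · refine (coordAt_line 1).unique (((((hs.pow 3).mul hb).add ((ht.pow 3).mul hd)).add
      ((((hs.mul hb).mul (ht.pow 2)).add (((hs.pow 2).mul ht).mul hd)).const_mul
        (3 * mu))).congr_deriv ?_)
    simp
    ring
  · refine (coordAt_line 2).unique
      (((((hs.pow 2).mul (hb.pow 2)).add ((ht.pow 2).mul (hd.pow 2))).add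
      (((((hb.pow 2).mul (ht.pow 2)).add ((((hs.const_mul 4).mul hb).mul ht).mul hd)).add
        ((hs.pow 2).mul (hd.pow 2))).const_mul mu)).congr_deriv ?_)
    simp
    ring

lemma eq_zero_of_hasLineDerivAt_coordAt_one {α β c : ℂ} (hα : α.re = 0)
    (h : HasLineDerivAt ℝ coordAt (c • coordAt (1, 0)) (1, 0) (α, β)) : α = 0 ∧ β = 0 := by
  obtain ⟨eq_zero, eq_one, eq_two⟩ := hasLineDerivAt_coordAt_one h
  have coordAt_one : coordAt (1, 0) = coord 1 := rfl
  rw [coordAt_one, coord_one] at eq_zero eq_one eq_two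
  simp only [Pi.smul_apply, smul_eq_mul, Matrix.cons_val, mul_one, mul_zero]
    at eq_zero eq_one eq_two
  have conj_α : conj α = -α := by
    apply Complex.ext <;> simp [hα]
  have c_eq_zero : c = 0 := by
    rw [conj_α, add_neg_cancel, mul_zero] at eq_two
    exact (mul_eq_zero.1 eq_two).resolve_right mu_ne_zero
  have conj_β : conj β = 3 * mu * β := by linear_combination eq_one
  refine ⟨by linear_combination c_eq_zero / 4 - eq_zero / 4, ?_⟩
  have β_eq := congrArg conj conj_β
  simp only [map_mul, map_ofNat (starRingEnd ℂ), conj_mu, Complex.conj_conj] at β_eq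
  linear_combination (-1 / 2 : ℂ) * β_eq + (3 / 2 * mu) * conj_β + (3 / 2 * β) * three_mul_mu_sq

lemma eq_zero_of_fderiv_coordAt_eq_smul (s t a b : ℂ) (hst : s * conj s + t * conj t = 1)
    (hab : (conj s * a + conj t * b).re = 0)
    (h : ∃ c : ℂ, fderiv ℝ coordAt (s, t) (a, b) = c • coordAt (s, t)) : a = 0 ∧ b = 0 := by
  obtain ⟨c, hc⟩ := h
  have lineDeriv := hasLineDerivAt_coordAt_mul (SU2.mk s t hst)⁻¹
    ((differentiable_coordAt (s, t)).hasFDerivAt.hasLineDerivAt (a, b))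
  have inv_apply_zero : (SU2.mk s t hst)⁻¹.1 0 0 = conj s := rfl
  have inv_apply_one : (SU2.mk s t hst)⁻¹.1 1 0 = -t := by
    change conj (-conj t) = -t
    rw [map_neg, Complex.conj_conj]
  set α := a * conj s + conj b * t with hα
  set β := b * conj s - conj a * t with hβ
  rw [hc, Matrix.mulVec_smul, ← coordAt_mul, inv_apply_zero, inv_apply_one] at lineDeriv
  have base_eq : (s * conj s - conj t * -t, t * conj s + conj s * -t) = ((1, 0) : ℂ × ℂ) :=
    Prod.ext (by linear_combination hst) (by ring)
  have tangent_eq : (a * conj s - conj b * -t, b * conj s + conj a * -t) = (α, β) :=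
    Prod.ext (by ring) (by ring)
  simp only [base_eq, tangent_eq] at lineDeriv
  have α_re : α.re = 0 := by
    rw [← hab, hα]
    simp only [Complex.add_re, Complex.mul_re, Complex.conj_re, Complex.conj_im]
    ring
  obtain ⟨α_eq_zero, β_eq_zero⟩ := eq_zero_of_hasLineDerivAt_coordAt_one α_re lineDeriv
  have a_eq : a = s * α - t * conj β := by
    simp only [hα, hβ, map_sub, map_mul, Complex.conj_conj]
    linear_combination -a * hst
  have b_eq : b = t * conj α + s * β := by
    simp only [hα, hβ, map_add, map_mul, Complex.conj_conj]
    linear_combination -b * hst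
  simp [a_eq, b_eq, α_eq_zero, β_eq_zero]

/-! ### Highest weight vectors of degrees two and three -/

lemma LPlus_eq : LPlus = (X 0 : MvPolynomial (Fin 5) ℂ) • pderiv 1 +
    (2 * X 1 : MvPolynomial (Fin 5) ℂ) • pderiv 2 +
    (3 * X 2 : MvPolynomial (Fin 5) ℂ) • pderiv 3 +
    (4 * X 3 : MvPolynomial (Fin 5) ℂ) • pderiv 4 := by
  refine derivation_ext fun i => ?_
  fin_cases i <;> simp [LPlus, pderiv_X]

lemma LZ_eq : LZ = (2 * X 0 : MvPolynomial (Fin 5) ℂ) • pderiv 0 +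
    (X 1 : MvPolynomial (Fin 5) ℂ) • pderiv 1 - (X 3 : MvPolynomial (Fin 5) ℂ) • pderiv 3 -
    (2 * X 4 : MvPolynomial (Fin 5) ℂ) • pderiv 4 := by
  refine derivation_ext fun i => ?_
  fin_cases i <;> simp [LZ, pderiv_X]

lemma coeff_ofNat_mul {R σ : Type*} [CommSemiring R] (m : σ →₀ ℕ) (k : ℕ) [k.AtLeastTwo]
    (F : MvPolynomial σ R) : coeff m (ofNat(k) * F) = ofNat(k) * coeff m F := by
  rw [← map_ofNat C, coeff_C_mul]

lemma coeff_X_mul_pderiv_self {R σ : Type*} [CommSemiring R] (m : σ →₀ ℕ) (i : σ)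
    (F : MvPolynomial σ R) : coeff m (X i * pderiv i F) = m i * coeff m F := by
  classical
  induction F using MvPolynomial.induction_on' with
  | monomial n c =>
    rw [X_mul_pderiv_monomial, coeff_smul, nsmul_eq_mul, coeff_monomial]
    split_ifs with h
    · rw [h]
    · rw [mul_zero, mul_zero]
  | add p q hp hq => rw [map_add, mul_add, coeff_add, hp, hq, coeff_add, mul_add]

lemma coeff_LZ (m : Fin 5 →₀ ℕ) (F : MvPolynomial (Fin 5) ℂ) :
    coeff m (LZ F) = (2 * m 0 + m 1 - m 3 - 2 * m 4 : ℂ) * coeff m F := by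
  simp only [LZ_eq, Derivation.coe_sub, Derivation.coe_add, Derivation.coe_smul, Pi.sub_apply,
    Pi.add_apply, Pi.smul_apply, smul_eq_mul, mul_assoc, coeff_sub, coeff_add, coeff_ofNat_mul,
    coeff_X_mul_pderiv_self]
  ring

/-- The exponent of a monomial in five variables, from the list of its values; this allows one to
write `exponent ![1, 0, 0, 0, 1]` for that of `X 0 * X 4`. -/
def exponent : (Fin 5 → ℕ) → Fin 5 →₀ ℕ := Finsupp.equivFunOnFinite.symm

lemma coeff_LPlus (F : MvPolynomial (Fin 5) ℂ) (a b c d e : ℕ) :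
    coeff (exponent ![a, b, c, d, e]) (LPlus F) =
      (if a = 0 then 0 else (b + 1) * coeff (exponent ![a - 1, b + 1, c, d, e]) F) +
      2 * (if b = 0 then 0 else (c + 1) * coeff (exponent ![a, b - 1, c + 1, d, e]) F) +
      3 * (if c = 0 then 0 else (d + 1) * coeff (exponent ![a, b, c - 1, d + 1, e]) F) +
      4 * (if d = 0 then 0 else (e + 1) * coeff (exponent ![a, b, c, d - 1, e + 1]) F) := by
  have coeff_X_mul_pderiv {i j : Fin 5} {n : Fin 5 →₀ ℕ} (hij : i ≠ j)
      (hn : ∀ l, exponent ![a, b, c, d, e] l - Finsupp.single i 1 l + Finsupp.single j 1 l = n l) :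
      coeff (exponent ![a, b, c, d, e]) (X i * pderiv j F) =
        if exponent ![a, b, c, d, e] i = 0 then 0 else
          (exponent ![a, b, c, d, e] j + 1) * coeff n F := by
    have n_eq : exponent ![a, b, c, d, e] - Finsupp.single i 1 + Finsupp.single j 1 = n :=
      Finsupp.ext hn
    rw [coeff_X_mul', coeff_pderiv, n_eq, Finsupp.tsub_apply, Finsupp.single_eq_of_ne hij.symm,
      tsub_zero]
    simp only [Finsupp.mem_support_iff, ite_not, mul_comm]
  simp only [LPlus_eq, Derivation.coe_add, Derivation.coe_smul,
    Pi.add_apply, Pi.smul_apply, smul_eq_mul, mul_assoc, coeff_add, coeff_ofNat_mul]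
  rw [coeff_X_mul_pderiv (n := exponent ![a - 1, b + 1, c, d, e]) (by decide),
    coeff_X_mul_pderiv (n := exponent ![a, b - 1, c + 1, d, e]) (by decide),
    coeff_X_mul_pderiv (n := exponent ![a, b, c - 1, d + 1, e]) (by decide),
    coeff_X_mul_pderiv (n := exponent ![a, b, c, d - 1, e + 1]) (by decide)]
  · rfl
  all_goals
    intro l
    fin_cases l <;> simp [exponent]

lemma mem_highestWeight_iff {d j : ℕ} {F : MvPolynomial (Fin 5) ℂ} : F ∈ highestWeight d j ↔
    F.IsHomogeneous d ∧ LPlus F = 0 ∧ LZ F = (j : ℂ) • F := by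
  simp [highestWeight, Submodule.mem_inf, mem_homogeneousSubmodule]

lemma weight_of_mem_support {j : ℕ} {F : MvPolynomial (Fin 5) ℂ} (hF : LZ F = (j : ℂ) • F)
    {m : Fin 5 →₀ ℕ} (hm : m ∈ F.support) : 2 * m 0 + m 1 = j + m 3 + 2 * m 4 := by
  have coeff_eq := coeff_LZ m F
  rw [hF, coeff_smul, smul_eq_mul] at coeff_eq
  have cast_eq : (2 * m 0 + m 1 : ℂ) = j + m 3 + 2 * m 4 := by
    linear_combination -mul_right_cancel₀ (mem_support_iff.1 hm) coeff_eq
  exact_mod_cast cast_eq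

lemma sum_eq_of_mem_support {d : ℕ} {F : MvPolynomial (Fin 5) ℂ} (hF : F.IsHomogeneous d)
    {m : Fin 5 →₀ ℕ} (hm : m ∈ F.support) : ∑ i, m i = d := by
  rw [← hF (mem_support_iff.1 hm), Finsupp.weight_apply, Finsupp.sum_fintype _ _ (by simp)]
  simp

section HighestWeight

variable {d d' j j' : ℕ} {F G : MvPolynomial (Fin 5) ℂ}

lemma mul_mem_highestWeight (hF : F ∈ highestWeight d j) (hG : G ∈ highestWeight d' j') :
    F * G ∈ highestWeight (d + d') (j + j') := by
  obtain ⟨hF_hom, hF_plus, hF_z⟩ := mem_highestWeight_iff.1 hF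
  obtain ⟨hG_hom, hG_plus, hG_z⟩ := mem_highestWeight_iff.1 hG
  refine mem_highestWeight_iff.2 ⟨hF_hom.mul hG_hom, ?_, ?_⟩
  · rw [Derivation.leibniz, hF_plus, hG_plus, smul_zero, smul_zero, add_zero]
  · rw [Derivation.leibniz, hF_z, hG_z]
    simp only [smul_eq_C_mul, smul_eq_mul, Nat.cast_add, C_add]
    ring

lemma eq_zero_of_mem_highestWeight (hF : F ∈ highestWeight d j) (T : Finset (Fin 5 → ℕ))
    (hT : ∀ m ∈ Finset.Nat.antidiagonalTuple 5 d, 2 * m 0 + m 1 = j + m 3 + 2 * m 4 → m ∈ T)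
    (h : ∀ m ∈ T, coeff (exponent m) F = 0) : F = 0 := by
  obtain ⟨F_hom, -, F_z⟩ := mem_highestWeight_iff.1 hF
  rw [← support_eq_empty, Finset.eq_empty_iff_forall_notMem]
  intro m hm
  have exponent_coe : exponent m = m := Finsupp.equivFunOnFinite.symm_apply_apply m
  have coeff_eq_zero := h m (hT m (Finset.Nat.mem_antidiagonalTuple.2
    (sum_eq_of_mem_support F_hom hm)) (weight_of_mem_support F_z hm))
  rw [exponent_coe] at coeff_eq_zero
  exact mem_support_iff.1 hm coeff_eq_zero

lemma highestWeight_eq_bot_of_gt (h : 2 * d < j) : highestWeight d j = ⊥ := by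
  refine (Submodule.eq_bot_iff _).2 fun F hF => eq_zero_of_mem_highestWeight hF ∅ ?_ (by simp)
  intro m hm hw
  rw [Finset.Nat.mem_antidiagonalTuple, Fin.sum_univ_five] at hm
  omega

lemma coeff_LPlus_eq_zero (hF : F ∈ highestWeight d j) (m : Fin 5 →₀ ℕ) :
    coeff m (LPlus F) = 0 := by
  rw [(mem_highestWeight_iff.1 hF).2.1, coeff_zero]

end HighestWeight

lemma X_zero_mem : X 0 ∈ highestWeight 1 2 :=
  mem_highestWeight_iff.2 ⟨isHomogeneous_X ℂ 0, by simp [LPlus], by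
    simp [LZ, smul_eq_C_mul, map_ofNat C]⟩

lemma quadInvariant_mem : quadInvariant ∈ highestWeight 2 0 := by
  have mul_two (i j : Fin 5) : (X i * X j : MvPolynomial (Fin 5) ℂ).IsHomogeneous 2 :=
    (isHomogeneous_X ℂ i).mul (isHomogeneous_X ℂ j)
  refine mem_highestWeight_iff.2 ⟨?_, ?_, ?_⟩
  · rw [quadInvariant, mul_assoc 4]
    exact ((mul_two 0 4).sub (isHomogeneous_ofNat_mul (mul_two 1 3) 4)).add
      (isHomogeneous_ofNat_mul (isHomogeneous_X_pow 2 2) 3)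
  · simp [quadInvariant, LPlus, Derivation.leibniz_pow]
    ring
  · simp [quadInvariant, LZ, Derivation.leibniz_pow]
    ring

lemma hessCovariant_mem : hessCovariant ∈ highestWeight 2 2 := by
  refine mem_highestWeight_iff.2 ⟨?_, ?_, ?_⟩
  · exact ((isHomogeneous_X ℂ 0).mul (isHomogeneous_X ℂ 2)).sub (isHomogeneous_X_pow 1 2)
  · simp [hessCovariant, LPlus, Derivation.leibniz_pow]
    ring
  · simp [hessCovariant, LZ, Derivation.leibniz_pow, smul_eq_C_mul, map_ofNat C]
    ring

lemma cubicInvariant_mem : cubicInvariant ∈ highestWeight 3 0 := by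
  refine mem_highestWeight_iff.2 ⟨isHomogeneous_cubicInvariant, ?_, ?_⟩
  · simp [cubicInvariant, LPlus, Derivation.leibniz_pow]
    ring
  · simp [cubicInvariant, LZ, Derivation.leibniz_pow]
    ring

lemma cubicCovariant_mem : cubicCovariant ∈ highestWeight 3 3 := by
  refine mem_highestWeight_iff.2 ⟨?_, ?_, ?_⟩
  · rw [cubicCovariant, mul_assoc 3, mul_assoc 3]
    exact (((isHomogeneous_X_pow 0 2).mul (isHomogeneous_X ℂ 3)).sub (isHomogeneous_ofNat_mul
      (((isHomogeneous_X ℂ 0).mul (isHomogeneous_X ℂ 1)).mul (isHomogeneous_X ℂ 2)) 3)).add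
        (isHomogeneous_ofNat_mul (isHomogeneous_X_pow 1 3) 2)
  · simp [cubicCovariant, LPlus, Derivation.leibniz_pow]
    ring
  · simp [cubicCovariant, LZ, Derivation.leibniz_pow, smul_eq_C_mul, map_ofNat C]
    ring

lemma quadInvariant_ne_zero : quadInvariant ≠ 0 :=
  ne_zero_of_map (f := eval ![1, 0, 0, 0, 1]) (by simp [quadInvariant])

lemma hessCovariant_ne_zero : hessCovariant ≠ 0 :=
  ne_zero_of_map (f := eval ![1, 0, 1, 0, 0]) (by simp [hessCovariant])

lemma cubicInvariant_ne_zero : cubicInvariant ≠ 0 :=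
  ne_zero_of_map (f := eval ![0, 0, 1, 0, 0]) (by simp [cubicInvariant])

lemma cubicCovariant_ne_zero : cubicCovariant ≠ 0 :=
  ne_zero_of_map (f := eval ![1, 0, 0, 1, 0]) (by simp [cubicCovariant])

lemma eq_span_singleton_of_forall_eq_zero {K M : Type*} [Field K] [AddCommGroup M] [Module K M]
    {S : Submodule K M} (φ : M →ₗ[K] K) (hφ : ∀ x ∈ S, φ x = 0 → x = 0) {y : M} (hy : y ∈ S)
    (y_ne_zero : y ≠ 0) : S = Submodule.span K {y} := by
  refine le_antisymm (fun x hx => ?_) ((Submodule.span_singleton_le_iff_mem y S).2 hy)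
  have φ_ne_zero : φ y ≠ 0 := mt (hφ y hy) y_ne_zero
  refine Submodule.mem_span_singleton.2 ⟨φ x / φ y, (sub_eq_zero.1 (hφ _ ?_ ?_)).symm⟩
  · exact S.sub_mem hx (S.smul_mem _ hy)
  · rw [map_sub, map_smul, smul_eq_mul, div_mul_cancel₀ _ φ_ne_zero, sub_self]

lemma highestWeight_two_zero : highestWeight 2 0 = Submodule.span ℂ {quadInvariant} := by
  refine eq_span_singleton_of_forall_eq_zero (lcoeff ℂ (exponent ![1, 0, 0, 0, 1]))
    (fun F hF hF0 => ?_) quadInvariant_mem quadInvariant_ne_zero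
  have eq₀ := coeff_LPlus_eq_zero hF (exponent ![1, 0, 0, 1, 0])
  have eq₁ := coeff_LPlus_eq_zero hF (exponent ![0, 1, 1, 0, 0])
  refine eq_zero_of_mem_highestWeight hF
    {![1, 0, 0, 0, 1], ![0, 1, 0, 1, 0], ![0, 0, 2, 0, 0]} (by decide) ?_
  grind [coeff_LPlus, lcoeff_apply]

lemma highestWeight_two_one : highestWeight 2 1 = ⊥ := by
  refine (Submodule.eq_bot_iff _).2 fun F hF => ?_
  have eq₀ := coeff_LPlus_eq_zero hF (exponent ![1, 0, 1, 0, 0])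
  have eq₁ := coeff_LPlus_eq_zero hF (exponent ![0, 2, 0, 0, 0])
  refine eq_zero_of_mem_highestWeight hF {![1, 0, 0, 1, 0], ![0, 1, 1, 0, 0]} (by decide) ?_
  grind [coeff_LPlus]

lemma highestWeight_two_two : highestWeight 2 2 = Submodule.span ℂ {hessCovariant} := by
  refine eq_span_singleton_of_forall_eq_zero (lcoeff ℂ (exponent ![1, 0, 1, 0, 0]))
    (fun F hF hF0 => ?_) hessCovariant_mem hessCovariant_ne_zero
  have eq := coeff_LPlus_eq_zero hF (exponent ![1, 1, 0, 0, 0])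
  refine eq_zero_of_mem_highestWeight hF {![1, 0, 1, 0, 0], ![0, 2, 0, 0, 0]} (by decide) ?_
  grind [coeff_LPlus, lcoeff_apply]

lemma highestWeight_two_three : highestWeight 2 3 = ⊥ := by
  refine (Submodule.eq_bot_iff _).2 fun F hF => ?_
  have eq := coeff_LPlus_eq_zero hF (exponent ![2, 0, 0, 0, 0])
  refine eq_zero_of_mem_highestWeight hF {![1, 1, 0, 0, 0]} (by decide) ?_
  grind [coeff_LPlus]

lemma highestWeight_two_four : highestWeight 2 4 = Submodule.span ℂ {X 0 * X 0} := by
  refine eq_span_singleton_of_forall_eq_zero (lcoeff ℂ (exponent ![2, 0, 0, 0, 0]))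
    (fun F hF hF0 => ?_)
    (mul_mem_highestWeight X_zero_mem X_zero_mem)
    (mul_ne_zero (X_ne_zero 0) (X_ne_zero 0))
  refine eq_zero_of_mem_highestWeight hF {![2, 0, 0, 0, 0]} (by decide) ?_
  grind [coeff_LPlus, lcoeff_apply]

lemma highestWeight_three_zero : highestWeight 3 0 = Submodule.span ℂ {cubicInvariant} := by
  refine eq_span_singleton_of_forall_eq_zero (lcoeff ℂ (exponent ![1, 0, 1, 0, 1]))
    (fun F hF hF0 => ?_) cubicInvariant_mem cubicInvariant_ne_zero
  have eq₀ := coeff_LPlus_eq_zero hF (exponent ![1, 1, 0, 0, 1])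
  have eq₁ := coeff_LPlus_eq_zero hF (exponent ![1, 0, 1, 1, 0])
  have eq₂ := coeff_LPlus_eq_zero hF (exponent ![0, 2, 0, 1, 0])
  have eq₃ := coeff_LPlus_eq_zero hF (exponent ![0, 1, 2, 0, 0])
  refine eq_zero_of_mem_highestWeight hF
    {![1, 0, 1, 0, 1], ![1, 0, 0, 2, 0], ![0, 2, 0, 0, 1], ![0, 1, 1, 1, 0],
     ![0, 0, 3, 0, 0]} (by decide) ?_
  grind [coeff_LPlus, lcoeff_apply]

lemma highestWeight_three_one : highestWeight 3 1 = ⊥ := by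
  refine (Submodule.eq_bot_iff _).2 fun F hF => ?_
  have eq₀ := coeff_LPlus_eq_zero hF (exponent ![2, 0, 0, 0, 1])
  have eq₁ := coeff_LPlus_eq_zero hF (exponent ![1, 1, 0, 1, 0])
  have eq₂ := coeff_LPlus_eq_zero hF (exponent ![1, 0, 2, 0, 0])
  have eq₃ := coeff_LPlus_eq_zero hF (exponent ![0, 2, 1, 0, 0])
  refine eq_zero_of_mem_highestWeight hF
    {![1, 1, 0, 0, 1], ![1, 0, 1, 1, 0], ![0, 2, 0, 1, 0], ![0, 1, 2, 0, 0]} (by decide) ?_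
  grind [coeff_LPlus]

lemma highestWeight_three_two : highestWeight 3 2 = Submodule.span ℂ {quadInvariant * X 0} := by
  refine eq_span_singleton_of_forall_eq_zero (lcoeff ℂ (exponent ![2, 0, 0, 0, 1]))
    (fun F hF hF0 => ?_)
    (mul_mem_highestWeight quadInvariant_mem X_zero_mem)
    (mul_ne_zero quadInvariant_ne_zero (X_ne_zero 0))
  have eq₀ := coeff_LPlus_eq_zero hF (exponent ![2, 0, 0, 1, 0])
  have eq₁ := coeff_LPlus_eq_zero hF (exponent ![1, 1, 1, 0, 0])
  have eq₂ := coeff_LPlus_eq_zero hF (exponent ![0, 3, 0, 0, 0])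
  refine eq_zero_of_mem_highestWeight hF
    {![2, 0, 0, 0, 1], ![1, 1, 0, 1, 0], ![1, 0, 2, 0, 0], ![0, 2, 1, 0, 0]} (by decide) ?_
  grind [coeff_LPlus, lcoeff_apply]

lemma highestWeight_three_three : highestWeight 3 3 = Submodule.span ℂ {cubicCovariant} := by
  refine eq_span_singleton_of_forall_eq_zero (lcoeff ℂ (exponent ![2, 0, 0, 1, 0]))
    (fun F hF hF0 => ?_) cubicCovariant_mem cubicCovariant_ne_zero
  have eq₀ := coeff_LPlus_eq_zero hF (exponent ![2, 0, 1, 0, 0])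
  have eq₁ := coeff_LPlus_eq_zero hF (exponent ![1, 2, 0, 0, 0])
  refine eq_zero_of_mem_highestWeight hF
    {![2, 0, 0, 1, 0], ![1, 1, 1, 0, 0], ![0, 3, 0, 0, 0]} (by decide) ?_
  grind [coeff_LPlus, lcoeff_apply]

lemma highestWeight_three_four : highestWeight 3 4 = Submodule.span ℂ {hessCovariant * X 0} := by
  refine eq_span_singleton_of_forall_eq_zero (lcoeff ℂ (exponent ![2, 0, 1, 0, 0]))
    (fun F hF hF0 => ?_)
    (mul_mem_highestWeight hessCovariant_mem X_zero_mem)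
    (mul_ne_zero hessCovariant_ne_zero (X_ne_zero 0))
  have eq := coeff_LPlus_eq_zero hF (exponent ![2, 1, 0, 0, 0])
  refine eq_zero_of_mem_highestWeight hF {![2, 0, 1, 0, 0], ![1, 2, 0, 0, 0]} (by decide) ?_
  grind [coeff_LPlus, lcoeff_apply]

lemma highestWeight_three_five : highestWeight 3 5 = ⊥ := by
  refine (Submodule.eq_bot_iff _).2 fun F hF => ?_
  have eq := coeff_LPlus_eq_zero hF (exponent ![3, 0, 0, 0, 0])
  refine eq_zero_of_mem_highestWeight hF {![2, 1, 0, 0, 0]} (by decide) ?_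
  grind [coeff_LPlus]

lemma highestWeight_three_six : highestWeight 3 6 = Submodule.span ℂ {X 0 * X 0 * X 0} := by
  refine eq_span_singleton_of_forall_eq_zero (lcoeff ℂ (exponent ![3, 0, 0, 0, 0]))
    (fun F hF hF0 => ?_)
    (mul_mem_highestWeight (mul_mem_highestWeight X_zero_mem X_zero_mem) X_zero_mem)
    (mul_ne_zero (mul_ne_zero (X_ne_zero 0) (X_ne_zero 0)) (X_ne_zero 0))
  refine eq_zero_of_mem_highestWeight hF {![3, 0, 0, 0, 0]} (by decide) ?_
  grind [coeff_LPlus, lcoeff_apply]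

lemma finrank_highestWeight_two (j : ℕ) : Module.finrank ℂ (highestWeight 2 j) =
    if j ∈ ({0, 2, 4} : Finset ℕ) then 1 else 0 := by
  rcases Nat.lt_or_ge 4 j with hj | hj
  · rw [highestWeight_eq_bot_of_gt hj, finrank_bot, if_neg]
    simp only [Finset.mem_insert, Finset.mem_singleton]
    omega
  · interval_cases j
    · rw [highestWeight_two_zero, finrank_span_singleton quadInvariant_ne_zero]
      rfl
    · rw [highestWeight_two_one, finrank_bot]
      rfl
    · rw [highestWeight_two_two, finrank_span_singleton hessCovariant_ne_zero]
      rfl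
    · rw [highestWeight_two_three, finrank_bot]
      rfl
    · rw [highestWeight_two_four, finrank_span_singleton (mul_ne_zero (X_ne_zero 0) (X_ne_zero 0))]
      rfl

lemma finrank_highestWeight_three (j : ℕ) : Module.finrank ℂ (highestWeight 3 j) =
    if j ∈ ({0, 2, 3, 4, 6} : Finset ℕ) then 1 else 0 := by
  rcases Nat.lt_or_ge 6 j with hj | hj
  · rw [highestWeight_eq_bot_of_gt hj, finrank_bot, if_neg]
    simp only [Finset.mem_insert, Finset.mem_singleton]
    omega
  · interval_cases j
    · rw [highestWeight_three_zero, finrank_span_singleton cubicInvariant_ne_zero]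
      rfl
    · rw [highestWeight_three_one, finrank_bot]
      rfl
    · rw [highestWeight_three_two,
        finrank_span_singleton (mul_ne_zero quadInvariant_ne_zero (X_ne_zero 0))]
      rfl
    · rw [highestWeight_three_three, finrank_span_singleton cubicCovariant_ne_zero]
      rfl
    · rw [highestWeight_three_four,
        finrank_span_singleton (mul_ne_zero hessCovariant_ne_zero (X_ne_zero 0))]
      rfl
    · rw [highestWeight_three_five, finrank_bot]
      rfl
    · rw [highestWeight_three_six,
        finrank_span_singleton
          (mul_ne_zero (mul_ne_zero (X_ne_zero 0) (X_ne_zero 0)) (X_ne_zero 0))]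
      rfl

/-! ### Values of the covariants on the sphere -/

lemma eval_coord_quadInvariant (p : SU2) : eval (coord p) quadInvariant = 0 := by
  rw [← eval_spherePoint_aeval_multiplet, aeval_multiplet_quadInvariant, map_zero]

lemma eval_coord_hessCovariant (p : SU2) :
    eval (coord p) hessCovariant = mu * eval (st p) formVbar := by
  rw [← eval_spherePoint_aeval_multiplet, aeval_multiplet_hessCovariant, map_mul, map_mul, map_pow,
    eval_spherePoint_normForm, eval_spherePoint_inclForm, eval_C, one_pow, mul_one]

lemma eval_coord_cubicCovariant (p : SU2) :
    eval (coord p) cubicCovariant = 4 * eval (st p) formP := by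
  rw [← eval_spherePoint_aeval_multiplet, aeval_multiplet_cubicCovariant, map_mul, map_mul, map_pow,
    eval_spherePoint_normForm, eval_spherePoint_inclForm, map_ofNat, one_pow, mul_one]

lemma eval_coord_hessCovariant_mul (p : SU2) :
    eval (coord p) (hessCovariant * X 0) = mu * eval (st p) formW := by
  rw [map_mul, eval_coord_hessCovariant, eval_X, coord_apply_zero, ← formV_mul_formVbar, map_mul,
    mul_assoc, mul_comm (eval (st p) formVbar)]

lemma eval_coord_X_zero_cube (p : SU2) :
    eval (coord p) (X 0 * X 0 * X 0) = 1 * eval (st p) (formV ^ 3) := by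
  rw [← pow_three', map_pow, eval_X, coord_apply_zero, map_pow, one_mul]

lemma eval_coord_descendant_hessCovariant (p : SU2) (l : Fin 5) :
    eval (coord p) (descendant LMinus 4 l hessCovariant) =
      mu * binaryCoeff (-mu) (p.1 0 0) (p.1 1 0) (p.1 0 1) (p.1 1 1) l := by
  rw [← eval_spherePoint_aeval_multiplet, aeval_multiplet_descendant_hessCovariant, map_mul,
    map_mul, map_pow, eval_spherePoint_normForm, eval_spherePoint_genericCoeff, eval_C, one_pow,
    mul_one]

lemma conj_coord (p : SU2) (l : Fin 5) : conj (coord p l) = (-1) ^ (l : ℕ) *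
    binaryCoeff (-mu) (p.1 0 0) (p.1 1 0) (p.1 0 1) (p.1 1 1) l.rev := by
  rw [← binaryCoeff_reverse, coord_eq, map_binaryCoeff, conj_mu, p.apply_zero_one,
    p.apply_one_one, map_neg, Complex.conj_conj, Complex.conj_conj, neg_neg]

lemma exists_ne_zero_of_mem_span_singleton {K M : Type*} [Semiring K] [AddCommMonoid M] [Module K M]
    {x y : M} (hx : x ∈ Submodule.span K {y}) (h0 : x ≠ 0) : ∃ a : K, a ≠ 0 ∧ x = a • y := by
  obtain ⟨a, rfl⟩ := Submodule.mem_span_singleton.1 hx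
  exact ⟨a, left_ne_zero_of_smul h0, rfl⟩

lemma exists_conj_coord_eq {F : MvPolynomial (Fin 5) ℂ} (hF : F ∈ highestWeight 2 2)
    (h0 : F ≠ 0) : ∃ c : ℂ, c ≠ 0 ∧ ∀ p, ∀ l : Fin 5, conj (coord p l) =
      c * (-1) ^ (l : ℕ) * eval (coord p) (descendant LMinus 4 (4 - l) F) := by
  rw [highestWeight_two_two] at hF
  obtain ⟨a, ha, rfl⟩ := exists_ne_zero_of_mem_span_singleton hF h0
  have mu_ne_zero := mu_ne_zero
  refine ⟨(a * mu)⁻¹, inv_ne_zero (mul_ne_zero ha mu_ne_zero), fun p l => ?_⟩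
  have rev_eq : (l.rev : ℕ) = 4 - l := by
    rw [Fin.val_rev]
    lia
  rw [descendant_smul, smul_eval, ← rev_eq, eval_coord_descendant_hessCovariant, conj_coord]
  field_simp

lemma exists_eval_coord_eq {F G : MvPolynomial (Fin 5) ℂ} {φ : MvPolynomial (Fin 2) ℂ} {e : ℂ}
    (he : e ≠ 0) (hG : ∀ p, eval (coord p) G = e * eval (st p) φ)
    (hF : F ∈ Submodule.span ℂ {G}) (h0 : F ≠ 0) :
    ∃ c : ℂ, c ≠ 0 ∧ ∀ p, eval (coord p) F = c * eval (st p) φ := by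
  obtain ⟨a, ha, rfl⟩ := exists_ne_zero_of_mem_span_singleton hF h0
  exact ⟨a * e, mul_ne_zero ha he, fun p => by rw [smul_eval, hG, mul_assoc]⟩

lemma exists_eval_eq_iff_pow_three_eq_one {K : MvPolynomial (Fin 5) ℂ} (hK : K ∈ highestWeight 3 0)
    (h0 : K ≠ 0) : ∃ c : ℂ, c ≠ 0 ∧ (∀ p, eval (coord p) K = c) ∧
      ∀ p, ∀ z : Fin 5 → ℂ, (∃ a : ℂ, a ≠ 0 ∧ z = a • coord p) →
        (eval z K = c ↔ ∃ ζ : ℂ, ζ ^ 3 = 1 ∧ z = ζ • coord p) := by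
  have isHomogeneous := (mem_highestWeight_iff.1 hK).1
  rw [highestWeight_three_zero] at hK
  obtain ⟨b, hb, rfl⟩ := exists_ne_zero_of_mem_span_singleton hK h0
  have value_ne_zero : b * (4 / 3 * mu) ≠ 0 :=
    mul_ne_zero hb (mul_ne_zero (by norm_num) mu_ne_zero)
  have eval_eq (p : SU2) : eval (coord p) (b • cubicInvariant) = b * (4 / 3 * mu) := by
    rw [smul_eval, eval_coord_cubicInvariant]
  refine ⟨_, value_ne_zero, eval_eq, ?_⟩
  rintro p z ⟨a, -, rfl⟩
  rw [eval_smul_of_isHomogeneous isHomogeneous, eval_eq, mul_eq_right₀ value_ne_zero]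
  constructor
  · exact fun h => ⟨a, h, rfl⟩
  · rintro ⟨ζ, hζ, h⟩
    rwa [smul_left_injective ℂ (coord_ne_zero p) h]

lemma mem_highestWeight_three_two_iff (F : MvPolynomial (Fin 5) ℂ) :
    F ∈ highestWeight 3 2 ↔ ∃ Q ∈ highestWeight 2 0, F = Q * X 0 := by
  rw [highestWeight_three_two, highestWeight_two_zero]
  simp only [Submodule.mem_span_singleton, eq_comm (a := F)]
  simp only [exists_exists_eq_and, smul_mul_assoc]

/-! ### Relations between the coordinates -/

lemma eq_zero_of_forall_eval_conj_eq_zero {G : MvPolynomial (Fin 4) ℂ}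
    (h : ∀ s t : ℂ, eval ![s, t, conj s, conj t] G = 0) : G = 0 := by
  -- In the variables `(s ± conj s) / 2`, `(t ± conj t) / 2` the points in question are the real
  -- points, which are Zariski dense.
  let φ : Fin 4 → MvPolynomial (Fin 4) ℂ :=
    ![X 0 + C Complex.I * X 2, X 1 + C Complex.I * X 3, X 0 - C Complex.I * X 2,
      X 1 - C Complex.I * X 3]
  have eval_aeval_φ (x : Fin 4 → ℂ) : eval x (aeval φ G) = eval ![x 0 + Complex.I * x 2,
      x 1 + Complex.I * x 3, x 0 - Complex.I * x 2, x 1 - Complex.I * x 3] G := by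
    rw [eval_aeval]
    congr 2
    ext i
    fin_cases i <;> simp [φ]
  have aeval_φ_eq_zero : aeval φ G = 0 := by
    refine funext_set (fun _ => Set.range ((↑) : ℝ → ℂ))
      (fun _ => Set.infinite_range_of_injective Complex.ofReal_injective) fun x hx => ?_
    choose y hy using fun i => hx i (Set.mem_univ i)
    rw [eval_aeval_φ, map_zero, ← h (x 0 + Complex.I * x 2) (x 1 + Complex.I * x 3)]
    simp [← hy, sub_eq_add_neg]
  refine MvPolynomial.funext fun x => ?_
  have preimage : ![(x 0 + x 2) / 2 + Complex.I * ((x 0 - x 2) / (2 * Complex.I)),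
      (x 1 + x 3) / 2 + Complex.I * ((x 1 - x 3) / (2 * Complex.I)),
      (x 0 + x 2) / 2 - Complex.I * ((x 0 - x 2) / (2 * Complex.I)),
      (x 1 + x 3) / 2 - Complex.I * ((x 1 - x 3) / (2 * Complex.I))] = x := by
    have I_ne_zero := Complex.I_ne_zero
    ext i
    fin_cases i <;> simp <;> field_simp <;> ring
  rw [← preimage, map_zero, ← map_zero (eval ![(x 0 + x 2) / 2, (x 1 + x 3) / 2,
    (x 0 - x 2) / (2 * Complex.I), (x 1 - x 3) / (2 * Complex.I)]), ← aeval_φ_eq_zero, eval_aeval_φ]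
  simp only [Matrix.cons_val]

lemma SU2.exists_eq_ofReal_mul (s t : ℂ) :
    ∃ (r : ℝ) (p : SU2), s = r * p.1 0 0 ∧ t = r * p.1 1 0 := by
  rcases eq_or_ne (Complex.normSq s + Complex.normSq t) 0 with h | h
  · have := (add_eq_zero_iff_of_nonneg (Complex.normSq_nonneg s) (Complex.normSq_nonneg t)).1 h
    exact ⟨0, 1, by simpa using Complex.normSq_eq_zero.1 this.1,
      by simpa using Complex.normSq_eq_zero.1 this.2⟩
  · have pos : 0 < Complex.normSq s + Complex.normSq t :=
      (add_nonneg (Complex.normSq_nonneg s) (Complex.normSq_nonneg t)).lt_of_ne h.symm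
    set r := Real.sqrt (Complex.normSq s + Complex.normSq t)
    have r_ne_zero : (r : ℂ) ≠ 0 := Complex.ofReal_ne_zero.2 (Real.sqrt_pos.2 pos).ne'
    have sq_r : (r : ℂ) ^ 2 = s * conj s + t * conj t := by
      rw [Complex.mul_conj, Complex.mul_conj, ← Complex.ofReal_add, ← Complex.ofReal_pow,
        Real.sq_sqrt pos.le]
    refine ⟨r, SU2.mk (s / r) (t / r) ?_, (mul_div_cancel₀ s r_ne_zero).symm,
      (mul_div_cancel₀ t r_ne_zero).symm⟩
    simp only [map_div₀, Complex.conj_ofReal]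
    field_simp
    exact sq_r.symm

-- The orbit of `V` under all linear substitutions is the complexification of the sphere.
lemma eval_binaryCoeff_eq_zero {n : ℕ} {F : MvPolynomial (Fin 5) ℂ} (hF : F.IsHomogeneous n)
    (h : ∀ p, eval (coord p) F = 0) (s t b d : ℂ) : eval (binaryCoeff mu s t b d) F = 0 := by
  have eval_aeval_multiplet (s t u w : ℂ) : eval ![s, t, u, w] (aeval multiplet F) =
      eval (binaryCoeff mu s t (-w) u) F := by
    rw [eval_aeval, multiplet_eq]
    congr 2
    ext l
    rw [genericCoeff, map_binaryCoeff]
    simp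
  have aeval_multiplet_eq_zero : aeval multiplet F = 0 := by
    refine eq_zero_of_forall_eval_conj_eq_zero fun s t => ?_
    obtain ⟨r, p, hs, ht⟩ := SU2.exists_eq_ofReal_mul s t
    have scaling : binaryCoeff mu s t (-conj t) (conj s) = (r : ℂ) ^ 4 • coord p := by
      rw [coord_eq, p.apply_zero_one, p.apply_one_one, hs, ht]
      ext l
      fin_cases l <;> simp [binaryCoeff] <;> ring
    rw [eval_aeval_multiplet, scaling, eval_smul_of_isHomogeneous hF, h p, mul_zero]
  rw [← neg_neg b, ← eval_aeval_multiplet, aeval_multiplet_eq_zero, map_zero]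

lemma sum_filter_eq_zero_of_forall_sum_pow_eq_zero {ι K : Type*} [Fintype ι] [CommRing K]
    [IsDomain K] [Infinite K] (w : ι → ℕ) (a : ι → K) (h : ∀ y, ∑ i, a i * y ^ w i = 0) (k : ℕ) :
    ∑ i with w i = k, a i = 0 := by
  have poly_eq_zero : ∑ i, Polynomial.monomial (w i) (a i) = 0 :=
    Polynomial.funext fun y => by
      simpa only [Polynomial.eval_finsetSum, Polynomial.eval_monomial, Polynomial.eval_zero]
        using h y
  have coeff_eq_zero := congrArg (Polynomial.coeff · k) poly_eq_zero
  simpa only [Polynomial.finsetSum_coeff, Polynomial.coeff_monomial, Finset.sum_filter,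
    Polynomial.coeff_zero] using coeff_eq_zero

lemma binaryCoeff_mul_right {A : Type*} [CommRing A] (m s t b d y : A) (l : Fin 5) :
    binaryCoeff m s t (y * b) (y * d) l = binaryCoeff m s t b d l * y ^ (l : ℕ) := by
  fin_cases l <;> simp [binaryCoeff] <;> ring

lemma exists_eq_sum_of_isHomogeneous_two {R σ : Type*} [CommSemiring R] [Fintype σ]
    {F : MvPolynomial σ R} (hF : F.IsHomogeneous 2) :
    ∃ c : σ × σ → R, F = ∑ i, c i • (X i.1 * X i.2) := by
  rw [← mem_homogeneousSubmodule, ← homogeneousSubmodule_one_pow,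
    homogeneousSubmodule_one_eq_span_X, sq, Submodule.span_mul_span, ← Set.image2_mul,
    Set.image2_range, Submodule.mem_span_range_iff_exists_fun] at hF
  obtain ⟨c, rfl⟩ := hF
  exact ⟨c, rfl⟩

lemma sum_antidiagonal_eq_zero {c : Fin 5 × Fin 5 → ℂ}
    (h : ∀ p, eval (coord p) (∑ i, c i • (X i.1 * X i.2)) = 0) (s t b d : ℂ) (k : ℕ) :
    ∑ i : Fin 5 × Fin 5 with (i.1 + i.2 : ℕ) = k,
      c i * (binaryCoeff mu s t b d i.1 * binaryCoeff mu s t b d i.2) = 0 := by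
  have isHomogeneous : (∑ i, c i • (X i.1 * X i.2) : MvPolynomial (Fin 5) ℂ).IsHomogeneous 2 :=
    IsHomogeneous.sum _ _ _ fun i _ => by
      rw [smul_eq_C_mul]
      exact ((isHomogeneous_X ℂ _).mul (isHomogeneous_X ℂ _)).C_mul _
  refine sum_filter_eq_zero_of_forall_sum_pow_eq_zero _ _ (fun y => ?_) k
  rw [← eval_binaryCoeff_eq_zero isHomogeneous h s t (y * b) (y * d)]
  simp only [map_sum, smul_eval, map_mul, eval_X, binaryCoeff_mul_right]
  exact Finset.sum_congr rfl fun i _ => by ring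

section QuadricCoefficients

variable {c : Fin 5 × Fin 5 → ℂ}

-- The relations of each weight are read off at the points `(1, 1, 1, 1, 1)`, `(1, 0, mu, 0, 1)`
-- and `(2 + 6 mu, 1 + 3 mu, 1 + mu, 1, 1)` of the orbit of `V`.

lemma coeff_weight_extremal
    (h : ∀ p, eval (coord p) (∑ i, c i • (X i.1 * X i.2)) = 0) :
    c (0, 0) = 0 ∧ c (0, 1) + c (1, 0) = 0 ∧ c (3, 4) + c (4, 3) = 0 ∧ c (4, 4) = 0 := by
  have at_one := sum_antidiagonal_eq_zero h 1 0 1 0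
  simp only [Finset.sum_filter, Fintype.sum_prod_type, Fin.sum_univ_five, binaryCoeff,
    Matrix.cons_val] at at_one
  exact ⟨by simpa using at_one 0, by simpa using at_one 1, by simpa using at_one 7,
    by simpa using at_one 8⟩

lemma coeff_weight_two
    (h : ∀ p, eval (coord p) (∑ i, c i • (X i.1 * X i.2)) = 0) :
    c (0, 2) + c (2, 0) = 0 ∧ c (1, 1) = 0 := by
  have at_one := sum_antidiagonal_eq_zero h 1 0 1 0 2
  have at_id := sum_antidiagonal_eq_zero h 1 0 0 1 2
  simp only [Finset.sum_filter, Fintype.sum_prod_type, Fin.sum_univ_five, binaryCoeff,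
    Matrix.cons_val] at at_one at_id
  have sum_eq : c (0, 2) + c (1, 1) + c (2, 0) = 0 := by simpa using at_one
  have mul_mu_sum_eq : c (0, 2) * mu + c (2, 0) * mu = 0 := by simpa using at_id
  grind [mu_ne_zero]

lemma coeff_weight_six
    (h : ∀ p, eval (coord p) (∑ i, c i • (X i.1 * X i.2)) = 0) :
    c (2, 4) + c (4, 2) = 0 ∧ c (3, 3) = 0 := by
  have at_one := sum_antidiagonal_eq_zero h 1 0 1 0 6
  have at_id := sum_antidiagonal_eq_zero h 1 0 0 1 6
  simp only [Finset.sum_filter, Fintype.sum_prod_type, Fin.sum_univ_five, binaryCoeff,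
    Matrix.cons_val] at at_one at_id
  have sum_eq : c (2, 4) + c (3, 3) + c (4, 2) = 0 := by simpa using at_one
  have mul_mu_sum_eq : c (2, 4) * mu + c (4, 2) * mu = 0 := by simpa using at_id
  grind [mu_ne_zero]

lemma coeff_weight_three
    (h : ∀ p, eval (coord p) (∑ i, c i • (X i.1 * X i.2)) = 0) :
    c (0, 3) + c (3, 0) = 0 ∧ c (1, 2) + c (2, 1) = 0 := by
  have at_one := sum_antidiagonal_eq_zero h 1 0 1 0 3
  have at_shear := sum_antidiagonal_eq_zero h 1 1 1 0 3
  simp only [Finset.sum_filter, Fintype.sum_prod_type, Fin.sum_univ_five, binaryCoeff,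
    Matrix.cons_val] at at_one at_shear
  have sum_eq : c (0, 3) + c (1, 2) + c (2, 1) + c (3, 0) = 0 := by
    simpa [add_assoc] using at_one
  have sum_shear_eq : c (0, 3) * (2 + 6 * mu) + c (1, 2) * ((1 + 3 * mu) * (1 + mu)) +
      c (2, 1) * ((1 + mu) * (1 + 3 * mu)) + c (3, 0) * (2 + 6 * mu) = 0 := by
    simpa [add_assoc, one_add_one_eq_two] using at_shear
  grind [mu_ne_zero, three_mul_mu_sq]

lemma coeff_weight_five
    (h : ∀ p, eval (coord p) (∑ i, c i • (X i.1 * X i.2)) = 0) :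
    c (1, 4) + c (4, 1) = 0 ∧ c (2, 3) + c (3, 2) = 0 := by
  have at_one := sum_antidiagonal_eq_zero h 1 0 1 0 5
  have at_shear := sum_antidiagonal_eq_zero h 1 1 1 0 5
  simp only [Finset.sum_filter, Fintype.sum_prod_type, Fin.sum_univ_five, binaryCoeff,
    Matrix.cons_val] at at_one at_shear
  have sum_eq : c (1, 4) + c (2, 3) + c (3, 2) + c (4, 1) = 0 := by
    simpa [add_assoc] using at_one
  have sum_shear_eq : c (1, 4) * (1 + 3 * mu) + c (2, 3) * (1 + mu) + c (3, 2) * (1 + mu) +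
      c (4, 1) * (1 + 3 * mu) = 0 := by
    simpa [add_assoc, one_add_one_eq_two] using at_shear
  grind [mu_ne_zero]

lemma coeff_weight_four
    (h : ∀ p, eval (coord p) (∑ i, c i • (X i.1 * X i.2)) = 0) :
    c (1, 3) + c (3, 1) = -4 * (c (0, 4) + c (4, 0)) ∧ c (2, 2) = 3 * (c (0, 4) + c (4, 0)) := by
  have at_one := sum_antidiagonal_eq_zero h 1 0 1 0 4
  have at_id := sum_antidiagonal_eq_zero h 1 0 0 1 4
  simp only [Finset.sum_filter, Fintype.sum_prod_type, Fin.sum_univ_five, binaryCoeff,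
    Matrix.cons_val] at at_one at_id
  have sum_eq : c (0, 4) + c (1, 3) + c (2, 2) + c (3, 1) + c (4, 0) = 0 := by
    simpa [add_assoc] using at_one
  have sum_mu_sq_eq : c (0, 4) + c (2, 2) * (mu * mu) + c (4, 0) = 0 := by simpa using at_id
  grind [three_mul_mu_sq]

lemma eq_smul_quadInvariant_of_forall_eq_zero
    (h : ∀ p, eval (coord p) (∑ i, c i • (X i.1 * X i.2)) = 0) :
    ∑ i, c i • (X i.1 * X i.2) = (c (0, 4) + c (4, 0)) • quadInvariant := by
  obtain ⟨weight_zero, weight_one, weight_seven, weight_eight⟩ := coeff_weight_extremal h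
  obtain ⟨weight_two, weight_two'⟩ := coeff_weight_two h
  obtain ⟨weight_three, weight_three'⟩ := coeff_weight_three h
  obtain ⟨weight_four, weight_four'⟩ := coeff_weight_four h
  obtain ⟨weight_five, weight_five'⟩ := coeff_weight_five h
  obtain ⟨weight_six, weight_six'⟩ := coeff_weight_six h
  refine MvPolynomial.funext fun x => ?_
  simp only [quadInvariant, map_add, map_sub, map_mul, map_pow, map_ofNat, eval_X,
    smul_eval, Fintype.sum_prod_type, Fin.sum_univ_five]
  linear_combination weight_zero * x 0 ^ 2 + weight_one * (x 0 * x 1) +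
    weight_two * (x 0 * x 2) + weight_two' * x 1 ^ 2 + weight_three * (x 0 * x 3) +
    weight_three' * (x 1 * x 2) + weight_four * (x 1 * x 3) + weight_four' * x 2 ^ 2 +
    weight_five * (x 1 * x 4) + weight_five' * (x 2 * x 3) + weight_six * (x 2 * x 4) +
    weight_six' * x 3 ^ 2 + weight_seven * (x 3 * x 4) + weight_eight * x 4 ^ 2

end QuadricCoefficients

lemma forall_eval_coord_eq_zero_iff {F : MvPolynomial (Fin 5) ℂ} (hF : F.IsHomogeneous 2) :
    (∀ p, eval (coord p) F = 0) ↔ F ∈ highestWeight 2 0 := by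
  rw [highestWeight_two_zero, Submodule.mem_span_singleton]
  constructor
  · intro h
    obtain ⟨c, rfl⟩ := exists_eq_sum_of_isHomogeneous_two hF
    exact ⟨_, (eq_smul_quadInvariant_of_forall_eq_zero h).symm⟩
  · rintro ⟨a, rfl⟩ p
    rw [smul_eval, eval_coord_quadInvariant, mul_zero]

lemma linearIndependent_coord :
    LinearIndependent ℂ (fun (l : Fin 5) (p : SU2) => coord p l) := by
  rw [Fintype.linearIndependent_iff]
  intro c hc k
  have isHomogeneous : (∑ l, C (c l) * X l : MvPolynomial (Fin 5) ℂ).IsHomogeneous 1 :=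
    IsHomogeneous.sum _ _ _ fun l _ => isHomogeneous_C_mul_X _ _
  have binaryCoeff_one (l : Fin 5) : binaryCoeff mu 1 0 1 0 l = 1 := by
    fin_cases l <;> simp [binaryCoeff]
  have torus (y : ℂ) : ∑ l, c l * y ^ (l : ℕ) = 0 := by
    rw [← eval_binaryCoeff_eq_zero isHomogeneous (fun p => by simpa using congrFun hc p)
      1 0 (y * 1) (y * 0)]
    simp only [map_sum, map_mul, eval_C, eval_X, binaryCoeff_mul_right, binaryCoeff_one, one_mul]
  simpa [Fin.val_inj, Finset.filter_eq'] using
    sum_filter_eq_zero_of_forall_sum_pow_eq_zero _ _ torus k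

/-! ### Invariant binary forms -/

section CyclicAverage

variable {K M : Type*} [Field K] [AddCommGroup M] [Module K M]

/-- The operator `(1 + T + ⋯ + T ^ (n - 1)) / n`. It fixes the fixed vectors of `T` and, when
`T ^ n = 1`, kills the eigenvectors for the other eigenvalues. -/
def cyclicAverage (n : ℕ) (T : Module.End K M) : Module.End K M :=
  (n : K)⁻¹ • ∑ i ∈ Finset.range n, T ^ i

variable {T : Module.End K M} {x : M} {n : ℕ}

lemma cyclicAverage_apply_of_apply_eq_smul {c : K} (h : T x = c • x) :
    cyclicAverage n T x = ((n : K)⁻¹ * ∑ i ∈ Finset.range n, c ^ i) • x := by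
  have pow_apply (i : ℕ) : (T ^ i) x = c ^ i • x := by
    induction i with
    | zero => rw [pow_zero, pow_zero, one_smul, Module.End.one_apply]
    | succ i ih => rw [pow_succ', Module.End.mul_apply, ih, map_smul, h, smul_smul, ← pow_succ]
  simp only [cyclicAverage, LinearMap.smul_apply, LinearMap.sum_apply, pow_apply,
    ← Finset.sum_smul, smul_smul]

lemma cyclicAverage_apply_of_apply_eq_self [CharZero K] (hn : n ≠ 0) (h : T x = x) :
    cyclicAverage n T x = x := by
  rw [cyclicAverage_apply_of_apply_eq_smul (h.trans (one_smul K x).symm)]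
  simp [hn]

lemma cyclicAverage_apply_of_isPrimitiveRoot [CharZero K] {ζ : K} (hζ : IsPrimitiveRoot ζ n)
    (hn : n ≠ 0) {m : ℕ} (h : T x = ζ ^ m • x) :
    cyclicAverage n T x = if n ∣ m then x else 0 := by
  split_ifs with dvd
  · rw [(hζ.pow_eq_one_iff_dvd m).2 dvd, one_smul] at h
    exact cyclicAverage_apply_of_apply_eq_self hn h
  · have ne_one : ζ ^ m ≠ 1 := mt (hζ.pow_eq_one_iff_dvd m).1 dvd
    rw [cyclicAverage_apply_of_apply_eq_smul h, geom_sum_eq ne_one, pow_right_comm,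
      hζ.pow_eq_one, one_pow, sub_self, zero_div, mul_zero, zero_smul]

end CyclicAverage

/-- The action of matrices on binary forms by linear substitution. -/
def linAct (g : Matrix (Fin 2) (Fin 2) ℂ) : MvPolynomial (Fin 2) ℂ →ₐ[ℂ] MvPolynomial (Fin 2) ℂ :=
  aeval fun i => C (g i 0) * X 0 + C (g i 1) * X 1

lemma eval_linAct (g : Matrix (Fin 2) (Fin 2) ℂ) (f : MvPolynomial (Fin 2) ℂ) (x : Fin 2 → ℂ) :
    eval x (linAct g f) = eval (g.mulVec x) f := by
  rw [linAct, eval_aeval]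
  congr 2
  ext i
  simp [Matrix.mulVec, dotProduct, Fin.sum_univ_two]

lemma linAct_genI_monomial (a b : ℕ) :
    linAct genI.1 (X 0 ^ a * X 1 ^ b) = Complex.I ^ (a + 3 * b) • (X 0 ^ a * X 1 ^ b) := by
  have neg_I : -Complex.I = Complex.I ^ 3 := by rw [Complex.I_pow_three]
  have apply_X_zero : linAct genI.1 (X 0) = Complex.I • X 0 := by
    simp [linAct, genI, smul_eq_C_mul]
  have apply_X_one : linAct genI.1 (X 1) = Complex.I ^ 3 • X 1 := by
    simp [linAct, genI, smul_eq_C_mul, ← neg_I]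
  rw [map_mul, map_pow, map_pow, apply_X_zero, apply_X_one, smul_pow, smul_pow,
    smul_mul_smul_comm, ← pow_mul, ← pow_add]

lemma linAct_genK_monomial (a b : ℕ) :
    linAct genK.1 (X 0 ^ a * X 1 ^ b) = Complex.I ^ (a + b) • (X 0 ^ b * X 1 ^ a) := by
  have apply_X_zero : linAct genK.1 (X 0) = Complex.I • X 1 := by
    simp [linAct, genK, SU2.mk, smul_eq_C_mul]
  have apply_X_one : linAct genK.1 (X 1) = Complex.I • X 0 := by
    simp [linAct, genK, SU2.mk, smul_eq_C_mul]
  rw [map_mul, map_pow, map_pow, apply_X_zero, apply_X_one, smul_pow, smul_pow,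
    smul_mul_smul_comm, ← pow_add, mul_comm (X 1 ^ a)]

lemma linAct_genI_formP : linAct genI.1 formP = formP := by
  refine MvPolynomial.funext fun x => ?_
  rw [eval_linAct]
  simp [formP, genI, dotProduct]
  grind [Complex.I_sq]

lemma linAct_genI_formW : linAct genI.1 formW = formW := by
  refine MvPolynomial.funext fun x => ?_
  rw [eval_linAct]
  simp [formW, genI, dotProduct]
  grind [Complex.I_sq]

lemma linAct_genOmega_formV : linAct genOmega.1 formV = zeta • formV := by
  refine MvPolynomial.funext fun x => ?_
  rw [eval_linAct, eval_formV_mulVec ⟨genOmega, genOmega_mem⟩, coe_tetraChar,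
    ← eq_coord_apply_zero coord_genOmega, smul_eval]

lemma linAct_genOmega_formVbar : linAct genOmega.1 formVbar = zeta ^ 2 • formVbar := by
  refine MvPolynomial.funext fun x => ?_
  have := three_mul_mu_sq
  rw [eval_linAct]
  simp [formVbar, ← six_mul_mu, genOmega, dotProduct, zeta]
  grind [Complex.I_sq]

lemma linAct_genOmega_formP : linAct genOmega.1 formP = formP := by
  refine MvPolynomial.funext fun x => ?_
  rw [eval_linAct]
  simp [formP, genOmega, dotProduct]
  grind [Complex.I_sq]

lemma linAct_genOmega_formW : linAct genOmega.1 formW = formW := by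
  rw [← formV_mul_formVbar, map_mul, linAct_genOmega_formV, linAct_genOmega_formVbar,
    smul_mul_smul_comm, ← pow_succ', zeta_pow_three, one_smul]

lemma eval_mulVec_of_linAct_eq {f : MvPolynomial (Fin 2) ℂ} (hI : linAct genI.1 f = f)
    (hOmega : linAct genOmega.1 f = f) {g : SU2} (hg : g ∈ tetra) (x : Fin 2 → ℂ) :
    eval (g.1.mulVec x) f = eval x f := by
  induction hg using Subgroup.closure_induction generalizing x with
  | mem y hy =>
    rcases hy with rfl | rfl
    · rw [← eval_linAct, hI]
    · rw [← eval_linAct, hOmega]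
  | one => rw [OneMemClass.coe_one, Matrix.one_mulVec]
  | mul a b _ _ ha hb => rw [Submonoid.coe_mul, ← Matrix.mulVec_mulVec, ha, hb]
  | inv a _ ha =>
    have mul_inv : a.1 * (a⁻¹).1 = 1 := congrArg Subtype.val (mul_inv_cancel a)
    rw [← ha, Matrix.mulVec_mulVec, mul_inv, Matrix.one_mulVec]

lemma eval_mulVec_of_mem_adjoin {f : MvPolynomial (Fin 2) ℂ}
    (hf : f ∈ Algebra.adjoin ℂ {formP, formW, formV ^ 3}) (g : tetra) (x : Fin 2 → ℂ) :
    eval (g.1.1.mulVec x) f = eval x f := by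
  induction hf using Algebra.adjoin_induction with
  | mem f hf =>
    rcases hf with rfl | rfl | rfl
    · exact eval_mulVec_of_linAct_eq linAct_genI_formP linAct_genOmega_formP g.2 x
    · exact eval_mulVec_of_linAct_eq linAct_genI_formW linAct_genOmega_formW g.2 x
    · rw [map_pow, eval_formV_mulVec, mul_pow, ← Units.val_pow_eq_pow_val, tetraChar_pow_three,
        Units.val_one, one_mul, map_pow]
  | algebraMap r => rw [algebraMap_eq, eval_C, eval_C]
  | add p q _ _ hp hq => rw [map_add, hp, hq, map_add]
  | mul p q _ _ hp hq => rw [map_mul, hp, hq, map_mul]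

/-- The algebra generated by `V`, its conjugate and `P`: the invariants of the quaternion group
generated by `genI` and `genK`. -/
def quatInvariants : Subalgebra ℂ (MvPolynomial (Fin 2) ℂ) :=
  Algebra.adjoin ℂ {formV, formVbar, formP}

lemma formV_mem_quatInvariants : formV ∈ quatInvariants :=
  Algebra.subset_adjoin (Set.mem_insert _ _)

lemma formVbar_mem_quatInvariants : formVbar ∈ quatInvariants :=
  Algebra.subset_adjoin (Set.mem_insert_of_mem _ (Set.mem_insert _ _))

lemma formP_mem_quatInvariants : formP ∈ quatInvariants :=
  Algebra.subset_adjoin (Set.mem_insert_of_mem _ (Set.mem_insert_of_mem _ rfl))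

lemma sq_mul_mem_quatInvariants : (X 0 * X 1) ^ 2 ∈ quatInvariants := by
  have smul_eq : (12 * mu) • (X 0 * X 1) ^ 2 = formV - formVbar := by
    rw [formV, formVbar, C_six_mul_mu, smul_eq_C_mul, map_mul, map_ofNat]
    ring
  have twelve_mul_mu_ne_zero : 12 * mu ≠ 0 := mul_ne_zero (by norm_num) mu_ne_zero
  refine ((Subalgebra.toSubmodule quatInvariants).smul_mem_iff twelve_mul_mu_ne_zero).1 ?_
  rw [smul_eq]
  exact sub_mem formV_mem_quatInvariants formVbar_mem_quatInvariants

lemma pow_four_add_pow_four_mem_quatInvariants : X 0 ^ 4 + X 1 ^ 4 ∈ quatInvariants := by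
  have smul_eq : (2 : ℂ) • (X 0 ^ 4 + X 1 ^ 4) = formV + formVbar := by
    rw [formV, formVbar, smul_eq_C_mul, map_ofNat]
    ring
  refine ((Subalgebra.toSubmodule quatInvariants).smul_mem_iff (two_ne_zero (α := ℂ))).1 ?_
  rw [smul_eq]
  exact add_mem formV_mem_quatInvariants formVbar_mem_quatInvariants

-- Both sequences satisfy the recursion `u (k + 2) = (s⁴ + t⁴) u (k + 1) - (s t)⁴ u k`.
lemma pow_add_pow_mem_and_pow_sub_pow_mem (k : ℕ) :
    (X 0 ^ 4) ^ k + (X 1 ^ 4) ^ k ∈ quatInvariants ∧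
      X 0 * X 1 * ((X 0 ^ 4) ^ k - (X 1 ^ 4) ^ k) ∈ quatInvariants := by
  induction k using Nat.twoStepInduction with
  | zero =>
    simp only [pow_zero, sub_self, mul_zero]
    exact ⟨add_mem (one_mem _) (one_mem _), zero_mem _⟩
  | one =>
    simp only [pow_one]
    exact ⟨pow_four_add_pow_four_mem_quatInvariants, formP_mem_quatInvariants⟩
  | more k ih ih_succ =>
    have recursion {u v w : MvPolynomial (Fin 2) ℂ} (hu : u ∈ quatInvariants)
        (hv : v ∈ quatInvariants)
        (hw : w = (X 0 ^ 4 + X 1 ^ 4) * v - ((X 0 * X 1) ^ 2) ^ 2 * u) : w ∈ quatInvariants :=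
      hw ▸ sub_mem (mul_mem pow_four_add_pow_four_mem_quatInvariants hv)
        (mul_mem (pow_mem sq_mul_mem_quatInvariants 2) hu)
    exact ⟨recursion ih.1 ih_succ.1 (by ring), recursion ih.2 ih_succ.2 (by ring)⟩

lemma symmetrization_mem_quatInvariants (r k : ℕ) :
    X 0 ^ (r + 4 * k) * X 1 ^ r + (-1) ^ r * (X 0 ^ r * X 1 ^ (r + 4 * k)) ∈ quatInvariants := by
  have neg_one_pow (n : ℕ) : (-1 : MvPolynomial (Fin 2) ℂ) ^ (2 * n) = 1 := by
    rw [pow_mul, neg_one_sq, one_pow]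
  obtain ⟨n, rfl | rfl⟩ := r.even_or_odd'
  · convert mul_mem (pow_mem sq_mul_mem_quatInvariants n)
      (pow_add_pow_mem_and_pow_sub_pow_mem k).1 using 1
    rw [neg_one_pow]
    ring
  · convert mul_mem (pow_mem sq_mul_mem_quatInvariants n)
      (pow_add_pow_mem_and_pow_sub_pow_mem k).2 using 1
    rw [pow_succ (-1), neg_one_pow]
    ring

lemma add_I_pow_smul_mem_quatInvariants {a b : ℕ} (h : 4 ∣ a + 3 * b) :
    X 0 ^ a * X 1 ^ b + Complex.I ^ (a + b) • (X 0 ^ b * X 1 ^ a) ∈ quatInvariants := by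
  have I_pow (r k : ℕ) : Complex.I ^ (r + 4 * k + r) = (-1) ^ r := by
    rw [show r + 4 * k + r = 2 * r + 4 * k by ring, pow_add, pow_mul, pow_mul, Complex.I_pow_four,
      Complex.I_sq, one_pow, mul_one]
  have C_neg_one_pow (r : ℕ) : C ((-1) ^ r) = ((-1) ^ r : MvPolynomial (Fin 2) ℂ) := by
    rw [map_pow, map_neg, map_one]
  rcases le_total b a with hba | hab
  · obtain ⟨k, rfl⟩ : ∃ k, a = b + 4 * k := ⟨(a - b) / 4, by lia⟩
    rw [I_pow, smul_eq_C_mul, C_neg_one_pow]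
    exact symmetrization_mem_quatInvariants b k
  · obtain ⟨k, rfl⟩ : ∃ k, b = a + 4 * k := ⟨(b - a) / 4, by lia⟩
    have neg_one_pow_mul_self : ((-1) ^ a * (-1) ^ a : MvPolynomial (Fin 2) ℂ) = 1 := by
      rw [← mul_pow, neg_one_mul, neg_neg, one_pow]
    rw [add_comm a (a + 4 * k), I_pow, smul_eq_C_mul, C_neg_one_pow]
    convert mul_mem (pow_mem (neg_mem (one_mem quatInvariants)) a)
      (symmetrization_mem_quatInvariants a k) using 1
    linear_combination (-X 0 ^ a * X 1 ^ (a + 4 * k)) * neg_one_pow_mul_self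

lemma map_mem_of_forall_monomial {R N : Type*} [CommSemiring R] [AddCommMonoid N] [Module R N]
    {M : Submodule R N} (T : MvPolynomial (Fin 2) R →ₗ[R] N)
    (h : ∀ a b : ℕ, T (X 0 ^ a * X 1 ^ b) ∈ M) (f : MvPolynomial (Fin 2) R) : T f ∈ M := by
  induction f using MvPolynomial.induction_on' with
  | monomial m c =>
    rw [monomial_eq, Finsupp.prod_fintype _ _ (fun _ => pow_zero _), Fin.prod_univ_two,
      ← smul_eq_C_mul, map_smul]
    exact M.smul_mem _ (h _ _)
  | add p q hp hq =>
    rw [map_add]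
    exact M.add_mem hp hq

lemma cyclicAverage_genK_genI_mem (f : MvPolynomial (Fin 2) ℂ) :
    cyclicAverage 2 (linAct genK.1).toLinearMap (cyclicAverage 4 (linAct genI.1).toLinearMap f) ∈
      quatInvariants := by
  refine map_mem_of_forall_monomial (M := Subalgebra.toSubmodule quatInvariants)
    (cyclicAverage 2 (linAct genK.1).toLinearMap ∘ₗ cyclicAverage 4 (linAct genI.1).toLinearMap)
    (fun a b => ?_) f
  rw [LinearMap.comp_apply, cyclicAverage_apply_of_isPrimitiveRoot isPrimitiveRoot_I four_ne_zero
    (linAct_genI_monomial a b)]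
  split_ifs with dvd
  · rw [cyclicAverage, Finset.sum_range_succ, Finset.sum_range_one, pow_zero, pow_one,
      LinearMap.smul_apply, LinearMap.add_apply, Module.End.one_apply, AlgHom.toLinearMap_apply,
      linAct_genK_monomial]
    exact Submodule.smul_mem _ _ (add_I_pow_smul_mem_quatInvariants dvd)
  · rw [map_zero]
    exact zero_mem _

lemma formVbar_pow_three : formVbar ^ 3 = formV ^ 3 - C (36 * mu) * formP ^ 2 := by
  rw [formV, formVbar, formP, C_six_mul_mu, map_mul, map_ofNat]
  linear_combination (-144 * C mu * (X 0 ^ 2 * X 1 ^ 2) ^ 3) * three_mul_C_mu_sq (σ := Fin 2)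

section MemOfGeneratorsMem

variable {A : Subalgebra ℂ (MvPolynomial (Fin 2) ℂ)}

lemma formV_pow_mul_formVbar_pow_mem (hP : formP ∈ A) (hW : formW ∈ A) (hV : formV ^ 3 ∈ A)
    {a b : ℕ} (h : 3 ∣ a + 2 * b) : formV ^ a * formVbar ^ b ∈ A := by
  have formVbar_pow_mem : formVbar ^ 3 ∈ A := by
    rw [formVbar_pow_three]
    exact sub_mem hV (mul_mem (A.algebraMap_mem _) (pow_mem hP 2))
  rcases le_total a b with hab | hba
  · obtain ⟨k, rfl⟩ : ∃ k, b = a + 3 * k := ⟨(b - a) / 3, by lia⟩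
    rw [pow_add, ← mul_assoc, ← mul_pow, formV_mul_formVbar, pow_mul]
    exact mul_mem (pow_mem hW _) (pow_mem formVbar_pow_mem _)
  · obtain ⟨k, rfl⟩ : ∃ k, a = b + 3 * k := ⟨(a - b) / 3, by lia⟩
    rw [pow_add, mul_right_comm, ← mul_pow, formV_mul_formVbar, pow_mul]
    exact mul_mem (pow_mem hW _) (pow_mem hV _)

lemma exists_eq_monomial_of_mem_closure {f : MvPolynomial (Fin 2) ℂ}
    (hf : f ∈ Submonoid.closure {formV, formVbar, formP}) :
    ∃ a b e : ℕ, f = formV ^ a * formVbar ^ b * formP ^ e := by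
  induction hf using Submonoid.closure_induction with
  | mem f hf =>
    rcases hf with rfl | rfl | rfl
    · exact ⟨1, 0, 0, by ring⟩
    · exact ⟨0, 1, 0, by ring⟩
    · exact ⟨0, 0, 1, by ring⟩
  | one => exact ⟨0, 0, 0, by ring⟩
  | mul f g _ _ hf hg =>
    obtain ⟨a, b, e, rfl⟩ := hf
    obtain ⟨a', b', e', rfl⟩ := hg
    exact ⟨a + a', b + b', e + e', by ring⟩

lemma cyclicAverage_genOmega_mem (hP : formP ∈ A) (hW : formW ∈ A) (hV : formV ^ 3 ∈ A)
    {f : MvPolynomial (Fin 2) ℂ} (hf : f ∈ quatInvariants) :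
    cyclicAverage 3 (linAct genOmega.1).toLinearMap f ∈ A := by
  rw [quatInvariants, ← Subalgebra.mem_toSubmodule, Algebra.adjoin_eq_span] at hf
  induction hf using Submodule.span_induction with
  | mem f hf =>
    obtain ⟨a, b, e, rfl⟩ := exists_eq_monomial_of_mem_closure hf
    have apply_eq_smul : linAct genOmega.1 (formV ^ a * formVbar ^ b * formP ^ e) =
        zeta ^ (a + 2 * b) • (formV ^ a * formVbar ^ b * formP ^ e) := by
      rw [map_mul, map_mul, map_pow, map_pow, map_pow, linAct_genOmega_formV,
        linAct_genOmega_formVbar, linAct_genOmega_formP, smul_pow, smul_pow, smul_mul_smul_comm,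
        smul_mul_assoc, ← pow_mul, ← pow_add]
    rw [cyclicAverage_apply_of_isPrimitiveRoot isPrimitiveRoot_zeta three_ne_zero apply_eq_smul]
    split_ifs with dvd
    · exact mul_mem (formV_pow_mul_formVbar_pow_mem hP hW hV dvd) (pow_mem hP e)
    · exact zero_mem A
  | zero =>
    rw [map_zero]
    exact zero_mem A
  | add f g _ _ hf hg =>
    rw [map_add]
    exact add_mem hf hg
  | smul c f _ hf =>
    rw [map_smul]
    exact A.smul_mem hf c

end MemOfGeneratorsMem

lemma invariant_iff_mem_adjoin (f : MvPolynomial (Fin 2) ℂ) :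
    (∀ (g : tetra) (x : Fin 2 → ℂ), eval (g.1.1.mulVec x) f = eval x f) ↔
      f ∈ Algebra.adjoin ℂ {formP, formW, formV ^ 3} := by
  refine ⟨fun h => ?_, eval_mulVec_of_mem_adjoin⟩
  have linAct_eq {g : SU2} (hg : g ∈ tetra) : (linAct g.1).toLinearMap f = f :=
    MvPolynomial.funext fun x => (eval_linAct _ _ _).trans (h ⟨g, hg⟩ x)
  have average_mem := cyclicAverage_genOmega_mem (A := Algebra.adjoin ℂ {formP, formW, formV ^ 3})
    (Algebra.subset_adjoin (by simp)) (Algebra.subset_adjoin (by simp))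
    (Algebra.subset_adjoin (by simp)) (cyclicAverage_genK_genI_mem f)
  rwa [cyclicAverage_apply_of_apply_eq_self four_ne_zero (linAct_eq genI_mem),
    cyclicAverage_apply_of_apply_eq_self two_ne_zero (linAct_eq genK_mem),
    cyclicAverage_apply_of_apply_eq_self three_ne_zero (linAct_eq genOmega_mem)] at average_mem

/-! ### Functions on the quotient -/

lemma JMinus_normForm_mul (G : MvPolynomial (Fin 4) ℂ) :
    JMinus (normForm * G) = normForm * JMinus G := by
  rw [Derivation.leibniz, JMinus_normForm, smul_zero, add_zero, smul_eq_mul]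

lemma JMinus_monomial_succ_left (a e c f : ℕ) :
    JMinus (X 0 ^ (a + 1) * X 1 ^ e * X 3 ^ c * X 2 ^ f) =
      (-(a + e + 1 : ℂ)) • (X 0 ^ a * X 1 ^ e * X 3 ^ (c + 1) * X 2 ^ f) +
        (e : ℂ) • (normForm * (X 0 ^ a * X 1 ^ (e - 1) * X 3 ^ c * X 2 ^ f)) := by
  simp only [Derivation.leibniz, Derivation.leibniz_pow, JMinus, mkDerivation_X, Matrix.cons_val,
    smul_eq_mul, normForm, nsmul_eq_mul, smul_eq_C_mul]
  cases e <;> simp <;> ring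

lemma JMinus_monomial_succ_right (a e c f : ℕ) :
    JMinus (X 0 ^ a * X 1 ^ (e + 1) * X 3 ^ c * X 2 ^ f) =
      (a + e + 1 : ℂ) • (X 0 ^ a * X 1 ^ e * X 3 ^ c * X 2 ^ (f + 1)) -
        (a : ℂ) • (normForm * (X 0 ^ (a - 1) * X 1 ^ e * X 3 ^ c * X 2 ^ f)) := by
  simp only [Derivation.leibniz, Derivation.leibniz_pow, JMinus, mkDerivation_X, Matrix.cons_val,
    smul_eq_mul, normForm, nsmul_eq_mul, smul_eq_C_mul]
  cases a <;> simp <;> ring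

section StableSubmodule

variable {N : Submodule ℂ (MvPolynomial (Fin 4) ℂ)}

lemma monomial_mem_of_JMinus_mem (hform : ∀ f, inclForm f ∈ N) (hJ : ∀ G ∈ N, JMinus G ∈ N)
    (hnorm : ∀ G ∈ N, normForm * G ∈ N) (a e c f : ℕ) :
    X 0 ^ a * X 1 ^ e * X 3 ^ c * X 2 ^ f ∈ N := by
  have cast_ne_zero (a e : ℕ) : (a + e + 1 : ℂ) ≠ 0 := mod_cast Nat.succ_ne_zero (a + e)
  induction c generalizing a e with
  | succ c ih =>
    have lowered_mem := hJ _ (ih (a + 1) e)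
    rw [JMinus_monomial_succ_left] at lowered_mem
    exact (N.smul_mem_iff (neg_ne_zero.2 (cast_ne_zero a e))).1
      ((N.add_mem_iff_left (N.smul_mem _ (hnorm _ (ih a (e - 1))))).1 lowered_mem)
  | zero =>
    induction f generalizing a e with
    | succ f ih =>
      have lowered_mem := hJ _ (ih a (e + 1))
      rw [JMinus_monomial_succ_right] at lowered_mem
      exact (N.smul_mem_iff (cast_ne_zero a e)).1
        ((N.sub_mem_iff_left (N.smul_mem _ (hnorm _ (ih (a - 1) e)))).1 lowered_mem)
    | zero =>
      have inclForm_eq : inclForm (X 0 ^ a * X 1 ^ e) = X 0 ^ a * X 1 ^ e := by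
        rw [inclForm, map_mul, map_pow, map_pow, rename_X, rename_X]
        rfl
      rw [pow_zero, pow_zero, mul_one, mul_one, ← inclForm_eq]
      exact hform _

lemma eq_top_of_JMinus_mem (hform : ∀ f, inclForm f ∈ N) (hJ : ∀ G ∈ N, JMinus G ∈ N)
    (hnorm : ∀ G ∈ N, normForm * G ∈ N) : N = ⊤ := by
  refine eq_top_iff.2 fun G _ => ?_
  induction G using MvPolynomial.induction_on' with
  | monomial m c =>
    have monomial_eq_smul : monomial m c =
        c • (X 0 ^ m 0 * X 1 ^ m 1 * X 3 ^ m 3 * X 2 ^ m 2 : MvPolynomial (Fin 4) ℂ) := by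
      rw [monomial_eq, Finsupp.prod_fintype _ _ (fun _ => pow_zero _), Fin.prod_univ_four,
        smul_eq_C_mul]
      ring
    rw [monomial_eq_smul]
    exact N.smul_mem _ (monomial_mem_of_JMinus_mem hform hJ hnorm _ _ _ _)
  | add p q hp hq => exact N.add_mem (hp trivial) (hq trivial)

end StableSubmodule

/-- The ideal of the polynomials in `s`, `t`, `conj s`, `conj t` generated by the equation of the
sphere. -/
def sphereIdeal : Ideal (MvPolynomial (Fin 4) ℂ) := Ideal.span {normForm - 1}

lemma mk_normForm : Ideal.Quotient.mk sphereIdeal normForm = 1 := by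
  rw [← map_one (Ideal.Quotient.mk sphereIdeal), Ideal.Quotient.eq]
  exact Ideal.subset_span rfl

lemma mk_JMinus_eq {G H : MvPolynomial (Fin 4) ℂ}
    (h : Ideal.Quotient.mk sphereIdeal G = Ideal.Quotient.mk sphereIdeal H) :
    Ideal.Quotient.mk sphereIdeal (JMinus G) = Ideal.Quotient.mk sphereIdeal (JMinus H) := by
  rw [Ideal.Quotient.eq, sphereIdeal, Ideal.mem_span_singleton] at h ⊢
  obtain ⟨K, hK⟩ := h
  exact ⟨JMinus K, by rw [← map_sub, hK, sub_mul, map_sub, JMinus_normForm_mul, one_mul, sub_mul,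
    one_mul]⟩

lemma eval_spherePoint_eq {G H : MvPolynomial (Fin 4) ℂ}
    (h : Ideal.Quotient.mk sphereIdeal G = Ideal.Quotient.mk sphereIdeal H) (p : SU2) :
    eval (spherePoint p) G = eval (spherePoint p) H := by
  rw [Ideal.Quotient.eq, sphereIdeal, Ideal.mem_span_singleton] at h
  obtain ⟨K, hK⟩ := h
  rw [← sub_eq_zero, ← map_sub, hK, map_mul, map_sub, eval_spherePoint_normForm, map_one, sub_self,
    zero_mul]

lemma isHomogeneous_derivation {R σ : Type*} [CommSemiring R]
    {D : Derivation R (MvPolynomial σ R) (MvPolynomial σ R)}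
    (hD : ∀ i, (D (X i)).IsHomogeneous 1) {n : ℕ} {F : MvPolynomial σ R}
    (hF : F.IsHomogeneous n) : (D F).IsHomogeneous n := by
  have eq_mkDerivation : D = mkDerivation R fun i => D (X i) :=
    derivation_ext fun i => (mkDerivation_X R (fun i => D (X i)) i).symm
  rw [F.as_sum, map_sum]
  refine IsHomogeneous.sum _ _ _ fun m hm => ?_
  rw [eq_mkDerivation, mkDerivation_monomial]
  refine (homogeneousSubmodule σ R n).smul_mem _ (IsHomogeneous.sum _ _ _ fun i hi => ?_)
  have single_le : Finsupp.single i 1 ≤ m :=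
    Finsupp.single_le_iff.2 (Nat.one_le_iff_ne_zero.2 (Finsupp.mem_support_iff.1 hi))
  have degree_eq : (m - Finsupp.single i 1).degree + 1 = n := by
    calc (m - Finsupp.single i 1).degree + 1
        = (m - Finsupp.single i 1 + Finsupp.single i 1).degree := by
          rw [map_add, Finsupp.degree_single]
      _ = n := by
          rw [tsub_add_cancel_of_le single_le, Finsupp.degree_eq_weight_one]
          exact hF (mem_support_iff.1 hm)
  exact degree_eq ▸ (isHomogeneous_monomial _ rfl).mul (hD i)

lemma isHomogeneous_LMinus {n : ℕ} {F : MvPolynomial (Fin 5) ℂ} (hF : F.IsHomogeneous n) :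
    (LMinus F).IsHomogeneous n := by
  refine isHomogeneous_derivation (fun i => ?_) hF
  fin_cases i <;>
    simp [LMinus, isHomogeneous_ofNat_mul, isHomogeneous_X, isHomogeneous_zero]

/-- The cubic invariant, normalized to take the value one on the sphere. -/
def unitCubic : MvPolynomial (Fin 5) ℂ := (4 / 3 * mu)⁻¹ • cubicInvariant

lemma isHomogeneous_unitCubic : unitCubic.IsHomogeneous 3 :=
  (homogeneousSubmodule (Fin 5) ℂ 3).smul_mem _ isHomogeneous_cubicInvariant

lemma mk_aeval_unitCubic : Ideal.Quotient.mk sphereIdeal (aeval multiplet unitCubic) = 1 := by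
  have inv_mul_cancel : (4 / 3 * mu)⁻¹ * (4 / 3 * mu) = 1 :=
    inv_mul_cancel₀ (mul_ne_zero (by norm_num) mu_ne_zero)
  rw [unitCubic, map_smul, aeval_multiplet_cubicInvariant, smul_eq_C_mul, ← mul_assoc, ← C_mul,
    inv_mul_cancel, C_1, one_mul, map_pow, mk_normForm, one_pow]

/-- The polynomials in `s`, `t`, `conj s`, `conj t` that are congruent, modulo the equation of the
sphere, to a form of degree divisible by three in the multiplet. Multiplication by powers of
`unitCubic` brings two such forms to the same degree, so that they can be added. -/
def tripleForms : Subalgebra ℂ (MvPolynomial (Fin 4) ℂ) where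
  carrier := {G | ∃ (n : ℕ) (F : MvPolynomial (Fin 5) ℂ), F.IsHomogeneous (3 * n) ∧
    Ideal.Quotient.mk sphereIdeal G = Ideal.Quotient.mk sphereIdeal (aeval multiplet F)}
  mul_mem' := by
    rintro G₁ G₂ ⟨n₁, F₁, hF₁, eq₁⟩ ⟨n₂, F₂, hF₂, eq₂⟩
    exact ⟨n₁ + n₂, F₁ * F₂, mul_add 3 n₁ n₂ ▸ hF₁.mul hF₂, by simp only [map_mul, eq₁, eq₂]⟩
  add_mem' := by
    rintro G₁ G₂ ⟨n₁, F₁, hF₁, eq₁⟩ ⟨n₂, F₂, hF₂, eq₂⟩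
    refine ⟨n₁ + n₂, F₁ * unitCubic ^ n₂ + F₂ * unitCubic ^ n₁, IsHomogeneous.add ?_ ?_, ?_⟩
    · rw [mul_add]
      exact hF₁.mul (isHomogeneous_unitCubic.pow n₂)
    · rw [add_comm, mul_add]
      exact hF₂.mul (isHomogeneous_unitCubic.pow n₁)
    · simp only [map_add, map_mul, map_pow, mk_aeval_unitCubic, eq₁, eq₂, one_pow, mul_one]
  algebraMap_mem' r := ⟨0, C r, isHomogeneous_C _ _, by rw [aeval_C]⟩

lemma JMinus_mem_tripleForms {G : MvPolynomial (Fin 4) ℂ} (hG : G ∈ tripleForms) :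
    JMinus G ∈ tripleForms := by
  obtain ⟨n, F, hF, mk_eq⟩ := hG
  refine ⟨n, LMinus F, isHomogeneous_LMinus hF, ?_⟩
  rw [mk_JMinus_eq mk_eq, multiplet_eq, JMinus_aeval_genericCoeff]

lemma normForm_mul_mem_tripleForms {G : MvPolynomial (Fin 4) ℂ} (hG : G ∈ tripleForms) :
    normForm * G ∈ tripleForms := by
  obtain ⟨n, F, hF, mk_eq⟩ := hG
  exact ⟨n, F, hF, by rw [map_mul, mk_normForm, one_mul, mk_eq]⟩

lemma mem_tripleForms_of_isHomogeneous_three {F : MvPolynomial (Fin 5) ℂ} (hF : F.IsHomogeneous 3)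
    {c : ℂ} (hc : c ≠ 0) {G : MvPolynomial (Fin 4) ℂ}
    (h : Ideal.Quotient.mk sphereIdeal (aeval multiplet F) =
      Ideal.Quotient.mk sphereIdeal (c • G)) : G ∈ tripleForms :=
  ((Subalgebra.toSubmodule tripleForms).smul_mem_iff hc).1 ⟨1, F, hF, h.symm⟩

lemma inclForm_formP_mem_tripleForms : inclForm formP ∈ tripleForms := by
  refine mem_tripleForms_of_isHomogeneous_three (mem_highestWeight_iff.1 cubicCovariant_mem).1
    (c := 4) (by norm_num) ?_
  rw [aeval_multiplet_cubicCovariant, smul_eq_C_mul, map_ofNat]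
  simp only [map_mul, map_pow, mk_normForm, one_pow, mul_one]

lemma inclForm_formW_mem_tripleForms : inclForm formW ∈ tripleForms := by
  refine mem_tripleForms_of_isHomogeneous_three
    (mem_highestWeight_iff.1 (mul_mem_highestWeight hessCovariant_mem X_zero_mem)).1 mu_ne_zero ?_
  rw [map_mul, aeval_X, aeval_multiplet_hessCovariant, multiplet_eq, ← inclForm_formV,
    smul_eq_C_mul, ← formV_mul_formVbar]
  simp only [map_mul, map_pow, mk_normForm, one_pow, mul_one]
  ring

lemma inclForm_formV_pow_three_mem_tripleForms : inclForm (formV ^ 3) ∈ tripleForms := by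
  refine mem_tripleForms_of_isHomogeneous_three (isHomogeneous_X_pow 0 3) one_ne_zero ?_
  rw [map_pow, aeval_X, multiplet_eq, ← inclForm_formV, one_smul, map_pow inclForm]

lemma inclForm_mem_tripleForms {f : MvPolynomial (Fin 2) ℂ}
    (hf : f ∈ Algebra.adjoin ℂ {formP, formW, formV ^ 3}) : inclForm f ∈ tripleForms := by
  have adjoin_le : Algebra.adjoin ℂ {formP, formW, formV ^ 3} ≤ tripleForms.comap inclForm := by
    rw [Algebra.adjoin_le_iff]
    rintro _ (rfl | rfl | rfl)
    exacts [inclForm_formP_mem_tripleForms, inclForm_formW_mem_tripleForms,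
      inclForm_formV_pow_three_mem_tripleForms]
  exact adjoin_le hf

/-- The action of matrices on polynomials in `s`, `t`, `conj s`, `conj t`: linear substitution in
`s` and `t`, and the contragredient one, for matrices of determinant one, in `conj s` and `conj t`.
On the sphere it is the action by left translations. -/
def sphereAct (g : Matrix (Fin 2) (Fin 2) ℂ) :
    MvPolynomial (Fin 4) ℂ →ₐ[ℂ] MvPolynomial (Fin 4) ℂ :=
  aeval ![C (g 0 0) * X 0 + C (g 0 1) * X 1, C (g 1 0) * X 0 + C (g 1 1) * X 1,
    C (g 1 1) * X 2 - C (g 1 0) * X 3, C (g 0 0) * X 3 - C (g 0 1) * X 2]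

lemma JMinus_sphereAct (g : Matrix (Fin 2) (Fin 2) ℂ) (G : MvPolynomial (Fin 4) ℂ) :
    JMinus (sphereAct g G) = sphereAct g (JMinus G) := by
  refine derivation_map_of_X JMinus JMinus (sphereAct g) (fun i => ?_) G
  fin_cases i <;> simp [sphereAct, JMinus] <;> ring

lemma sphereAct_normForm (g : SU2) : sphereAct g.1 normForm = normForm := by
  have C_det_eq := congrArg (C : ℂ → MvPolynomial (Fin 4) ℂ) g.det_eq
  simp only [map_sub, map_mul, map_one] at C_det_eq
  simp only [sphereAct, normForm, map_add, map_mul, aeval_X, Matrix.cons_val]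
  linear_combination (X 0 * X 2 + X 1 * X 3) * C_det_eq

lemma sphereAct_inclForm (g : Matrix (Fin 2) (Fin 2) ℂ) (f : MvPolynomial (Fin 2) ℂ) :
    sphereAct g (inclForm f) = inclForm (linAct g f) := by
  have comp_eq : (sphereAct g).comp inclForm = inclForm.comp (linAct g) := by
    refine algHom_ext fun i => ?_
    fin_cases i <;> simp [sphereAct, inclForm, linAct]
  exact DFunLike.congr_fun comp_eq f

lemma eval_sphereAct (g p : SU2) (G : MvPolynomial (Fin 4) ℂ) :
    eval (spherePoint p) (sphereAct g.1 G) = eval (spherePoint (g * p)) G := by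
  rw [sphereAct, eval_aeval]
  congr 2
  ext i
  fin_cases i <;> simp [spherePoint, Matrix.mul_apply, Fin.sum_univ_two, SU2.apply_zero_one,
    SU2.apply_one_one] <;> ring

instance fintype_tetra : Fintype tetra := Fintype.ofFinite tetra

/-- Averaging over the tetrahedral group acting by left translations. -/
def sphereAverage : MvPolynomial (Fin 4) ℂ →ₗ[ℂ] MvPolynomial (Fin 4) ℂ :=
  (Fintype.card tetra : ℂ)⁻¹ • ∑ g : tetra, (sphereAct g.1.1).toLinearMap

lemma sphereAverage_apply (G : MvPolynomial (Fin 4) ℂ) :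
    sphereAverage G = (Fintype.card tetra : ℂ)⁻¹ • ∑ g : tetra, sphereAct g.1.1 G := by
  rw [sphereAverage, LinearMap.smul_apply, LinearMap.sum_apply]
  rfl

lemma JMinus_sphereAverage (G : MvPolynomial (Fin 4) ℂ) :
    JMinus (sphereAverage G) = sphereAverage (JMinus G) := by
  simp only [sphereAverage_apply, Derivation.map_smul, map_sum, JMinus_sphereAct]

lemma sphereAverage_normForm_mul (G : MvPolynomial (Fin 4) ℂ) :
    sphereAverage (normForm * G) = normForm * sphereAverage G := by
  simp only [sphereAverage_apply, map_mul, sphereAct_normForm, mul_smul_comm, Finset.mul_sum]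

lemma sphereAverage_inclForm_mem_tripleForms (f : MvPolynomial (Fin 2) ℂ) :
    sphereAverage (inclForm f) ∈ tripleForms := by
  have sphereAverage_eq : sphereAverage (inclForm f) =
      inclForm ((Fintype.card tetra : ℂ)⁻¹ • ∑ g : tetra, linAct g.1.1 f) := by
    simp only [sphereAverage_apply, map_smul, map_sum, sphereAct_inclForm]
  rw [sphereAverage_eq]
  refine inclForm_mem_tripleForms ((invariant_iff_mem_adjoin _).1 fun γ x => ?_)
  simp only [smul_eval, map_sum, eval_linAct, Matrix.mulVec_mulVec]
  congr 1
  exact Fintype.sum_equiv (Equiv.mulRight γ) _ _ fun g => rfl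

lemma sphereAverage_mem_tripleForms (G : MvPolynomial (Fin 4) ℂ) :
    sphereAverage G ∈ tripleForms := by
  have comap_eq_top : (Subalgebra.toSubmodule tripleForms).comap sphereAverage = ⊤ := by
    refine eq_top_of_JMinus_mem sphereAverage_inclForm_mem_tripleForms (fun G hG => ?_)
      fun G hG => ?_
    · rw [Submodule.mem_comap, ← JMinus_sphereAverage]
      exact JMinus_mem_tripleForms hG
    · rw [Submodule.mem_comap, sphereAverage_normForm_mul]
      exact normForm_mul_mem_tripleForms hG
  exact Submodule.mem_comap.1 (comap_eq_top ▸ Submodule.mem_top)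

lemma eval_sphereAverage {f : Quot3 → ℂ} {G : MvPolynomial (Fin 4) ℂ}
    (h : ∀ p, f (proj p) = eval (spherePoint p) G) (p : SU2) :
    eval (spherePoint p) (sphereAverage G) = f (proj p) := by
  have eval_sphereAct_eq (g : tetra) : eval (spherePoint p) (sphereAct g.1.1 G) = f (proj p) := by
    rw [eval_sphereAct, ← h, (proj_eq_proj_iff (g.1 * p) p).2 ⟨g, rfl⟩]
  rw [sphereAverage_apply, smul_eval, map_sum]
  simp only [eval_sphereAct_eq, Finset.sum_const, Finset.card_univ, nsmul_eq_mul]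
  exact inv_mul_cancel_left₀ (Nat.cast_ne_zero.2 Fintype.card_ne_zero) _

lemma isPolynomialFunction_iff (f : Quot3 → ℂ) : IsPolynomialFunction f ↔
    ∃ (n : ℕ) (F : MvPolynomial (Fin 5) ℂ), F.IsHomogeneous (3 * n) ∧
      ∀ p, f (proj p) = eval (coord p) F := by
  constructor
  · rintro ⟨G, hG⟩
    obtain ⟨n, F, hF, mk_eq⟩ := sphereAverage_mem_tripleForms G
    refine ⟨n, F, hF, fun p => ?_⟩
    rw [← eval_spherePoint_aeval_multiplet, ← eval_spherePoint_eq mk_eq, eval_sphereAverage hG]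
  · rintro ⟨n, F, -, hF⟩
    exact ⟨aeval multiplet F, fun p => (hF p).trans (eval_spherePoint_aeval_multiplet p F).symm⟩

lemma eval_coord_mul_of_isHomogeneous {n : ℕ} {F : MvPolynomial (Fin 5) ℂ}
    (hF : F.IsHomogeneous (3 * n)) (γ : tetra) (p : SU2) :
    eval (coord (γ.1 * p)) F = eval (coord p) F := by
  rw [coord_mul_of_mem γ.2, eval_smul_of_isHomogeneous hF, pow_mul,
    coord_apply_zero_pow_three γ.2, one_pow, one_mul]

end TetrahedralQuotient

end

open TetrahedralQuotient MvPolynomial ComplexConjugate in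
theorem mainTheorem3 :
    -- `V`, hence its whole multiplet, is multiplied by a nontrivial cube-root-of-unity character
    (∃ χ : tetra →* ℂˣ, χ ≠ 1 ∧ (∀ γ, χ γ ^ 3 = 1) ∧
      (∀ (γ : tetra) (x : Fin 2 → ℂ),
        eval (γ.1.1.mulVec x) formV = (χ γ : ℂ) * eval x formV) ∧
      (∀ (γ : tetra) (p : SU2), coord (γ.1 * p) = (χ γ : ℂ) • coord p)) ∧
    -- the five functions are a spin 2 multiplet of the right action
    ((∀ l, JZ (multiplet l) = aeval multiplet (LZ (X l))) ∧
      (∀ l, JPlus (multiplet l) = aeval multiplet (LPlus (X l))) ∧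
      (∀ l, JMinus (multiplet l) = aeval multiplet (LMinus (X l))) ∧
      LinearIndependent ℂ (fun (l : Fin 5) (p : SU2) => coord p l) ∧
      (∀ g : SU2, ∃ A : Matrix (Fin 5) (Fin 5) ℂ, ∀ p, coord (p * g) = A.mulVec (coord p))) ∧
    -- they embed the quotient in projective space: topological embedding and immersion
    ((∀ p, coord p ≠ 0) ∧
      (∃ φ : Quot3 → Projectivization ℂ (Fin 5 → ℂ),
        (∀ p (h : coord p ≠ 0), φ (proj p) = Projectivization.mk ℂ (coord p) h) ∧
        Topology.IsEmbedding φ) ∧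
      (∀ s t a b : ℂ, s * conj s + t * conj t = 1 → (conj s * a + conj t * b).re = 0 →
        (∃ c : ℂ, fderiv ℝ coordAt (s, t) (a, b) = c • coordAt (s, t)) → a = 0 ∧ b = 0)) ∧
    -- quadratic combinations: spins 4, 2, 0; the spin 0 one is the only relation,
    -- the spin 2 one gives the reality conditions
    ((∀ j : ℕ, Module.finrank ℂ (highestWeight 2 j) =
        if j ∈ ({0, 2, 4} : Finset ℕ) then 1 else 0) ∧
      (∀ F : MvPolynomial (Fin 5) ℂ, F.IsHomogeneous 2 →
        ((∀ p, eval (coord p) F = 0) ↔ F ∈ highestWeight 2 0)) ∧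
      (∀ F ∈ highestWeight 2 2, F ≠ 0 →
        (∃ c : ℂ, c ≠ 0 ∧ ∀ p, eval (coord p) F = c * eval (st p) formVbar) ∧
        (∃ c : ℂ, c ≠ 0 ∧ ∀ p, ∀ l : Fin 5, conj (coord p l) =
          c * (-1) ^ (l : ℕ) * eval (coord p) (descendant LMinus 4 (4 - l) F)))) ∧
    -- cubic combinations: spins 0, 2, 3, 4, 6; normalisation by the spin 0 one
    ((∀ j : ℕ, Module.finrank ℂ (highestWeight 3 j) =
        if j ∈ ({0, 2, 3, 4, 6} : Finset ℕ) then 1 else 0) ∧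
      (∀ K ∈ highestWeight 3 0, K ≠ 0 → ∃ c : ℂ, c ≠ 0 ∧ (∀ p, eval (coord p) K = c) ∧
        ∀ p, ∀ z : Fin 5 → ℂ, (∃ a : ℂ, a ≠ 0 ∧ z = a • coord p) →
          (eval z K = c ↔ ∃ ζ : ℂ, ζ ^ 3 = 1 ∧ z = ζ • coord p)) ∧
      (∀ F, F ∈ highestWeight 3 2 ↔ ∃ Q ∈ highestWeight 2 0, F = Q * X 0) ∧
      (∀ F ∈ highestWeight 3 3, F ≠ 0 →
        ∃ c : ℂ, c ≠ 0 ∧ ∀ p, eval (coord p) F = c * eval (st p) formP) ∧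
      (∀ F ∈ highestWeight 3 4, F ≠ 0 →
        ∃ c : ℂ, c ≠ 0 ∧ ∀ p, eval (coord p) F = c * eval (st p) formW) ∧
      (∀ F ∈ highestWeight 3 6, F ≠ 0 →
        ∃ c : ℂ, c ≠ 0 ∧ ∀ p, eval (coord p) F = c * eval (st p) (formV ^ 3))) ∧
    -- the forms of degrees 6, 8, 12 just obtained are fundamental invariants
    (∀ f : MvPolynomial (Fin 2) ℂ,
      (∀ (γ : tetra) (x : Fin 2 → ℂ), eval (γ.1.1.mulVec x) f = eval x f) ↔
        f ∈ Algebra.adjoin ℂ {formP, formW, formV ^ 3}) ∧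
    -- the functions on the quotient are the polynomials of degree `3 n` in the coordinates
    ((∀ (n : ℕ) (F : MvPolynomial (Fin 5) ℂ), F.IsHomogeneous (3 * n) →
        ∀ (γ : tetra) (p : SU2), eval (coord (γ.1 * p)) F = eval (coord p) F) ∧
      (∀ f : Quot3 → ℂ, IsPolynomialFunction f ↔
        ∃ (n : ℕ) (F : MvPolynomial (Fin 5) ℂ), F.IsHomogeneous (3 * n) ∧
          ∀ p, f (proj p) = eval (coord p) F)) := by
  refine ⟨⟨tetraChar, tetraChar_ne_one, tetraChar_pow_three, eval_formV_mulVec,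
      fun γ p => coord_mul_of_mem γ.2 p⟩,
    ⟨fun l => multiplet_eq ▸ JZ_genericCoeff _ l, fun l => multiplet_eq ▸ JPlus_genericCoeff _ l,
      fun l => multiplet_eq ▸ JMinus_genericCoeff _ l, linearIndependent_coord,
      fun g => ⟨_, fun p => coord_mul p g⟩⟩,
    ⟨coord_ne_zero, ⟨quotientCoord, fun p _ => rfl, isEmbedding_quotientCoord⟩,
      eq_zero_of_fderiv_coordAt_eq_smul⟩,
    ⟨finrank_highestWeight_two, fun F hF => forall_eval_coord_eq_zero_iff hF, fun F hF h0 =>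
      ⟨exists_eval_coord_eq mu_ne_zero eval_coord_hessCovariant (highestWeight_two_two ▸ hF) h0,
        exists_conj_coord_eq hF h0⟩⟩,
    ⟨finrank_highestWeight_three, fun K hK h0 => exists_eval_eq_iff_pow_three_eq_one hK h0,
      mem_highestWeight_three_two_iff, fun F hF h0 => ?_, fun F hF h0 => ?_, fun F hF h0 => ?_⟩,
    invariant_iff_mem_adjoin,
    ⟨fun n F hF γ p => eval_coord_mul_of_isHomogeneous hF γ p, isPolynomialFunction_iff⟩⟩
  · exact exists_eval_coord_eq (e := 4) (by norm_num) eval_coord_cubicCovariant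
      (highestWeight_three_three ▸ hF) h0
  · exact exists_eval_coord_eq mu_ne_zero eval_coord_hessCovariant_mul
      (highestWeight_three_four ▸ hF) h0
  · exact exists_eval_coord_eq one_ne_zero eval_coord_X_zero_cube (highestWeight_three_six ▸ hF) h0
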